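/- Consider $n$ men $m_1,\dots,m_n$ placed in this order from top to bottom on a vertical line and $n$ women $w_1,\dots,w_n$ placed in this order from top to bottom on a parallel line. Each person $a$ has a strict preference list ranking some (not necessarily all) people of the opposite gender, those acceptable to $a$; being matched to an acceptable person is preferred to being unmatched. A matching is a set of disjoint man-woman pairs that are acceptable to each other. Edges $(m_i,w_x)$ and $(m_j,w_y)$ cross if $(i-j)(x-y)<0$, and a matching is noncrossing if no two of its edges cross. A noncrossing blocking pair with respect to a matching $M$ is a pair $(m,w)$ of a man and a woman not matched with each other in $M$ such that $m$ prefers $w$ to his situation in $M$, $w$ prefers $m$ to her situation in $M$, and $(m,w)$ crosses no edge of $M$. A weakly stable noncrossing matching is a noncrossing matching that admits no noncrossing blocking pair. There is an algorithm (a single program for a word RAM with words of $O(\log n)$ bits and unit-cost operations on words) that, given the preference lists of any such instance with $n$ men and $n$ women, finds a weakly stable noncrossing matching in $O(n^2)$ time, with a constant that depends neither on $n$ nor on the instance. -/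

import Mathlib

namespace StableNoncrossing

/-! ### Instances, matchings and stability

The men are `m_0, …, m_{n-1}` and the women `w_0, …, w_{n-1}`, each listed from top to bottom on
their line, so a person is an element of `Fin n`. -/

/-- An instance with `n` men and `n` women. Every person has a strict preference list, in
decreasing order of preference, of some (possibly none, possibly all) people of the other
gender: those that he or she finds acceptable. -/
structure Profile (n : ℕ) where
  men : Fin n → List (Fin n)
  women : Fin n → List (Fin n)
  men_nodup : ∀ i, (men i).Nodup
  women_nodup : ∀ j, (women j).Nodup

/-- The rank in the list `P`: the first entry has rank `1`, the second has rank `2`, and so on;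
`null` (that is, `none`) and people not on the list have rank `∞`. -/
def rank {n : ℕ} (P : List (Fin n)) : Option (Fin n) → ℕ∞
  | none => ⊤
  | some b => if b ∈ P then ((P.idxOf b + 1 : ℕ) : ℕ∞) else ⊤

/-- The owner of the list `P` prefers `b` to `c`. -/
def Prefers {n : ℕ} (P : List (Fin n)) (b c : Option (Fin n)) : Prop :=
  rank P b < rank P c

/-- The edge `(m_i, w_x)` crosses the edge `(m_j, w_y)`. -/
def Crosses {n : ℕ} (i x j y : Fin n) : Prop :=
  ((i : ℤ) - (j : ℤ)) * ((x : ℤ) - (y : ℤ)) < 0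

/-- A set of disjoint man-woman pairs is given by its two partner functions, `M` from men to
women and `M.symm` from women to men, with value `none` at an unmatched person. Its pairs are the
`(i, x)` with `M i = some x`. -/
abbrev Matching (n : ℕ) := Fin n ≃. Fin n

/-- All matched pairs are mutually acceptable. -/
def IsAcceptable {n : ℕ} (I : Profile n) (M : Matching n) : Prop :=
  ∀ i x, M i = some x → x ∈ I.men i ∧ i ∈ I.women x

/-- No two edges of the matching cross. -/
def IsNoncrossing {n : ℕ} (M : Matching n) : Prop :=
  ∀ i x j y, M i = some x → M j = some y → ¬ Crosses i x j y

/-- `(m_i, w_x)` is a blocking pair with respect to `M`. -/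
def IsBlockingPair {n : ℕ} (I : Profile n) (M : Matching n) (i x : Fin n) : Prop :=
  M i ≠ some x ∧ Prefers (I.men i) (some x) (M i) ∧ Prefers (I.women x) (some i) (M.symm x)

/-- `(m_i, w_x)` is a blocking pair that does not cross any edge of `M`. -/
def IsNoncrossingBlockingPair {n : ℕ} (I : Profile n) (M : Matching n) (i x : Fin n) : Prop :=
  IsBlockingPair I M i x ∧ ∀ j y, M j = some y → ¬ Crosses i x j y

/-- `M` is a weakly stable noncrossing matching of the instance `I`. -/
def IsWSNM {n : ℕ} (I : Profile n) (M : Matching n) : Prop :=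
  IsAcceptable I M ∧ IsNoncrossing M ∧ ∀ i x, ¬ IsNoncrossingBlockingPair I M i x

/-! ### The machine model: a word RAM -/

/-- The binary operations that the machine performs on words in unit time. -/
inductive Op
  | add | sub | mul | div | mod | land | lor | xor | shl | shr | lt | eq

/-- The value of an operation on natural numbers. Subtraction is truncated, a quotient by `0`
is `0` and a remainder by `0` is the dividend; comparisons give `1` or `0`. -/
def Op.eval : Op → ℕ → ℕ → ℕ
  | .add, a, b => a + b
  | .sub, a, b => a - b
  | .mul, a, b => a * b
  | .div, a, b => a / b
  | .mod, a, b => a % b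
  | .land, a, b => a &&& b
  | .lor, a, b => a ||| b
  | .xor, a, b => a ^^^ b
  | .shl, a, b => a <<< b
  | .shr, a, b => a >>> b
  | .lt, a, b => if a < b then 1 else 0
  | .eq, a, b => if a = b then 1 else 0

/-- Programs. Registers are named by natural numbers; a program mentions finitely many. -/
inductive Prog
  /-- do nothing -/
  | skip
  /-- register `d` receives the constant `v` -/
  | const (d v : ℕ)
  /-- register `d` receives the result of `o` on the contents of registers `a` and `b` -/
  | op (o : Op) (d a b : ℕ)
  /-- register `d` receives the memory cell whose address is in register `a` -/
  | load (d a : ℕ)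
  /-- the memory cell whose address is in register `a` receives the content of register `b` -/
  | store (a b : ℕ)
  /-- `p`, then `q` -/
  | seq (p q : Prog)
  /-- `p` if register `r` is nonzero, otherwise `q` -/
  | ite (r : ℕ) (p q : Prog)
  /-- repeat `p` as long as register `r` is nonzero -/
  | while (r : ℕ) (p : Prog)

/-- The registers and the random access memory. -/
structure State where
  reg : ℕ → ℕ
  mem : ℕ → ℕ

/-- The state after register `d` has received `v`. -/
def State.setReg (s : State) (d v : ℕ) : State := { s with reg := Function.update s.reg d v }

/-- The state after memory cell `a` has received `v`. -/
def State.setMem (s : State) (a v : ℕ) : State := { s with mem := Function.update s.mem a v }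

/-- `Exec w p s t s'`: on a machine with words of `w` bits, the program `p` started in state `s`
halts in state `s'` after exactly `t` steps. Every instruction and every test of a register
takes one step. A computed value that does not fit into a word is an error: there is then no
halting run. -/
inductive Exec (w : ℕ) : Prog → State → ℕ → State → Prop
  | skip (s : State) : Exec w .skip s 0 s
  | const (d v : ℕ) (s : State) (h : v < 2 ^ w) : Exec w (.const d v) s 1 (s.setReg d v)
  | op (o : Op) (d a b : ℕ) (s : State) (h : o.eval (s.reg a) (s.reg b) < 2 ^ w) :
      Exec w (.op o d a b) s 1 (s.setReg d (o.eval (s.reg a) (s.reg b)))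
  | load (d a : ℕ) (s : State) : Exec w (.load d a) s 1 (s.setReg d (s.mem (s.reg a)))
  | store (a b : ℕ) (s : State) : Exec w (.store a b) s 1 (s.setMem (s.reg a) (s.reg b))
  | seq {p q : Prog} {s s₁ s₂ : State} {t₁ t₂ : ℕ} (h₁ : Exec w p s t₁ s₁)
      (h₂ : Exec w q s₁ t₂ s₂) : Exec w (.seq p q) s (t₁ + t₂) s₂
  | ite_true {r : ℕ} {p q : Prog} {s s' : State} {t : ℕ} (hr : s.reg r ≠ 0)
      (h : Exec w p s t s') : Exec w (.ite r p q) s (t + 1) s'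
  | ite_false {r : ℕ} {p q : Prog} {s s' : State} {t : ℕ} (hr : s.reg r = 0)
      (h : Exec w q s t s') : Exec w (.ite r p q) s (t + 1) s'
  | while_true {r : ℕ} {p : Prog} {s s₁ s₂ : State} {t₁ t₂ : ℕ} (hr : s.reg r ≠ 0)
      (h₁ : Exec w p s t₁ s₁) (h₂ : Exec w (.while r p) s₁ t₂ s₂) :
      Exec w (.while r p) s (t₁ + t₂ + 1) s₂
  | while_false {r : ℕ} {p : Prog} {s : State} (hr : s.reg r = 0) :
      Exec w (.while r p) s 1 s

/-! ### Input and output format -/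

/-- A person, or `null`, as a machine word: the index of the person, and `n` for `null`. -/
def code {n : ℕ} : Option (Fin n) → ℕ
  | none => n
  | some b => b

/-- The preference lists in memory. Cell `i * n + k` holds the entry number `k` (counted from `0`)
of the list of man `m_i`, and cell `n * n + (i * n + k)` that of woman `w_i`, where a list with
fewer than `n` entries is padded with `null`. All other cells hold `0`. -/
def inputMem {n : ℕ} (I : Profile n) (a : ℕ) : ℕ :=
  if h : a < n * n then
    code (I.men ⟨a / n, Nat.div_lt_of_lt_mul h⟩)[a % n]?
  else if h : a - n * n < n * n then
    code (I.women ⟨(a - n * n) / n, Nat.div_lt_of_lt_mul h⟩)[(a - n * n) % n]?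
  else 0

/-- The initial state: register `0` holds `n`, the other registers hold `0`, and the memory holds
the preference lists. -/
def initState {n : ℕ} (I : Profile n) : State where
  reg := fun r => if r = 0 then n else 0
  mem := inputMem I

/-- In state `s`, the `n` memory cells that follow the input hold the matching `M`: cell
`2 * (n * n) + i` holds the partner of man `m_i`. -/
def Outputs {n : ℕ} (s : State) (M : Matching n) : Prop :=
  ∀ i : Fin n, s.mem (2 * (n * n) + i) = code (M i)

end StableNoncrossing

namespace StableNoncrossing

/-! ### Stable matchings of prefixes

People are natural numbers and `0` codes the absence of a partner, `x + 1` the partner `x`. The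
preferences are given by scores: `sm i c` is the score that man `i` gives to the partner coded by
`c`, and `sw x c` that of woman `x`; higher is better. -/

/-! Write `E k l` for `edges sm sw k l`. This matching is obtained by dynamic programming over pairs
of prefixes. At `(k + 1, l + 1)`, let `m` be the last man's partner in `E (k + 1) l` and `u` the
last woman's partner in `E k (l + 1)`. If man `k` and woman `l` prefer each other to `m` and `u`,
their edge is added to `E k l`; otherwise one of the two smaller matchings is kept unchanged.

Stability (`not_blocks_edges`) is an induction over both prefixes. If the edge `(k, l)` is added, a
pair of woman `l` with an earlier man would already block `E k (l + 1)`, because she has only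
improved on `u` (`not_blocks_column`); the same holds with the sexes exchanged. If a smaller
matching is kept and the last person of its longer side is matched there, that person's edge crosses
every pair of the omitted person except the corner `(k, l)`, and the case distinction prevents the
corner from blocking. If neither is matched, both smaller matchings equal `E k l`.

For the running time, matchings are never copied. If the last man of `E (k + 1) l` has partner `x`,
then `E (k + 1) l` is `(k, x)` together with `E k x`; if he is single, it is `E k l`. So the table
of `lastMan` determines everything: it is filled row by row, one cell per woman holding the current
`lastWoman`, and the matching is read off by tracing back from `(n, n)`. Inverting the preference
lists into a table of scores first makes every comparison a constant-time operation.

On the machine side, expressions are compiled to straight-line code (`Expr.exec_compile`), and the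
rules for `Runs` give total correctness with time bounds. Three countdown loops, with invariants
`ScoreInv`, `MatchInv` and `OutputInv`, make up the program. -/

/-- For the matching `edges sm sw k l` of the first `k` men and the first `l` women: the codes of
the partners of the last man and of the last woman. -/
def lastPartners (sm sw : ℕ → ℕ → ℕ) : ℕ → ℕ → ℕ × ℕ
  | 0, _ => (0, 0)
  | _ + 1, 0 => (0, 0)
  | k + 1, l + 1 =>
    let m := (lastPartners sm sw (k + 1) l).1
    let u := (lastPartners sm sw k (l + 1)).2
    if sm k m < sm k (l + 1) ∧ sw l u < sw l (k + 1) then (l + 1, k + 1)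
    -- If both `m` and `u` are partners, the matching to keep depends on whether woman `l` prefers
    -- man `k` to `u`: if so, he does not want her; if not, she does not want him. The disjunct `u =
    -- 0` keeps a matched last man even when she finds him unacceptable.
    else if m ≠ 0 ∧ (sw l u < sw l (k + 1) ∨ u = 0) then (m, 0) else (0, u)
termination_by k l => (k, l)

/-- The code of the partner of man `k - 1` in the matching of the first `k` men and `l` women. -/
def lastMan (sm sw : ℕ → ℕ → ℕ) (k l : ℕ) : ℕ := (lastPartners sm sw k l).1

/-- The code of the partner of woman `l - 1` in the matching of the first `k` men and `l` women. -/
def lastWoman (sm sw : ℕ → ℕ → ℕ) (k l : ℕ) : ℕ := (lastPartners sm sw k l).2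

/-- A weakly stable noncrossing matching of the first `k` men and the first `l` women. -/
def edges (sm sw : ℕ → ℕ → ℕ) : ℕ → ℕ → ℕ → ℕ → Prop
  | 0, _ => fun _ _ => False
  | _ + 1, 0 => fun _ _ => False
  | k + 1, l + 1 =>
    let m := lastMan sm sw (k + 1) l
    let u := lastWoman sm sw k (l + 1)
    if sm k m < sm k (l + 1) ∧ sw l u < sw l (k + 1) then
      fun i x => (i = k ∧ x = l) ∨ edges sm sw k l i x
    else if m ≠ 0 ∧ (sw l u < sw l (k + 1) ∨ u = 0) then edges sm sw (k + 1) l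
    else edges sm sw k (l + 1)
termination_by k l => (k, l)

/-- The pair `(i, x)` blocks the matching `E` without crossing it. -/
def Blocks (sm sw : ℕ → ℕ → ℕ) (E : ℕ → ℕ → Prop) (i x : ℕ) : Prop :=
  0 < sm i (x + 1) ∧ 0 < sw x (i + 1) ∧ (∀ y, E i y → sm i (y + 1) < sm i (x + 1)) ∧
    (∀ j, E j x → sw x (j + 1) < sw x (i + 1)) ∧
    ∀ j y, E j y → (j < i → y ≤ x) ∧ (i < j → x ≤ y)

theorem Blocks.swap {sm sw : ℕ → ℕ → ℕ} {E : ℕ → ℕ → Prop} {i x : ℕ} (h : Blocks sm sw E i x) :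
    Blocks sw sm (fun y j => E j y) x i := by
  obtain ⟨h1, h2, h3, h4, h5⟩ := h
  refine ⟨h2, h1, h4, h3, fun y j e => ?_⟩
  have := h5 j y e
  omega

/-! ### Structure of the recursive matchings. -/

section

variable {sm sw : ℕ → ℕ → ℕ}

@[simp] theorem lastMan_zero_left (l : ℕ) : lastMan sm sw 0 l = 0 := by
  simp [lastMan, lastPartners]

@[simp] theorem lastWoman_zero_left (l : ℕ) : lastWoman sm sw 0 l = 0 := by
  simp [lastWoman, lastPartners]

@[simp] theorem lastMan_zero_right (k : ℕ) : lastMan sm sw k 0 = 0 := by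
  cases k <;> simp [lastMan, lastPartners]

@[simp] theorem edges_zero_left (l i x : ℕ) : ¬ edges sm sw 0 l i x := by
  simp [edges]

@[simp] theorem edges_zero_right (k i x : ℕ) : ¬ edges sm sw k 0 i x := by
  cases k <;> simp [edges]

theorem lastMan_succ (k l : ℕ) : lastMan sm sw (k + 1) (l + 1) =
    if sm k (lastMan sm sw (k + 1) l) < sm k (l + 1) ∧
      sw l (lastWoman sm sw k (l + 1)) < sw l (k + 1) then l + 1
    else if lastMan sm sw (k + 1) l ≠ 0 ∧ (sw l (lastWoman sm sw k (l + 1)) < sw l (k + 1) ∨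
      lastWoman sm sw k (l + 1) = 0) then lastMan sm sw (k + 1) l else 0 := by
  unfold lastMan lastWoman
  conv_lhs => rw [lastPartners]
  split_ifs <;> rfl

theorem lastWoman_succ (k l : ℕ) : lastWoman sm sw (k + 1) (l + 1) =
    if sm k (lastMan sm sw (k + 1) l) < sm k (l + 1) ∧
      sw l (lastWoman sm sw k (l + 1)) < sw l (k + 1) then k + 1
    else if lastMan sm sw (k + 1) l ≠ 0 ∧ (sw l (lastWoman sm sw k (l + 1)) < sw l (k + 1) ∨
      lastWoman sm sw k (l + 1) = 0) then 0 else lastWoman sm sw k (l + 1) := by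
  unfold lastMan lastWoman
  conv_lhs => rw [lastPartners]
  split_ifs <;> rfl

theorem edges_succ (k l : ℕ) : edges sm sw (k + 1) (l + 1) =
    if sm k (lastMan sm sw (k + 1) l) < sm k (l + 1) ∧
      sw l (lastWoman sm sw k (l + 1)) < sw l (k + 1) then
      fun i x => (i = k ∧ x = l) ∨ edges sm sw k l i x
    else if lastMan sm sw (k + 1) l ≠ 0 ∧ (sw l (lastWoman sm sw k (l + 1)) < sw l (k + 1) ∨
      lastWoman sm sw k (l + 1) = 0) then edges sm sw (k + 1) l else edges sm sw k (l + 1) := by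
  rw [edges]

theorem edges_lt (k : ℕ) : ∀ l i x, edges sm sw k l i x → i < k ∧ x < l := by
  induction k with
  | zero => simp
  | succ k ihk =>
    intro l
    induction l with
    | zero => simp
    | succ l ihl =>
      intro i x h
      rw [edges_succ] at h
      split_ifs at h
      · rcases h with h | h
        · omega
        · have := ihk _ _ _ h
          omega
      · have := ihl _ _ h
        omega
      · have := ihk _ _ _ h
        omega

theorem edges_of_lastMan_eq_zero {k l : ℕ} (h : lastMan sm sw (k + 1) l = 0) :
    edges sm sw (k + 1) l = edges sm sw k l := by
  cases l with
  | zero => ext; simp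
  | succ l =>
    rw [lastMan_succ] at h
    rw [edges_succ]
    split_ifs at h ⊢ <;> first | rfl | omega

/-- An unmatched last woman can be deleted. The disjunct `u = 0` of the recursion is essential here:
when `E k (l + 1)` is kept although she is single in it, the last man must be single in `E (k + 1)
l` too. -/
theorem edges_of_lastWoman_eq_zero {k l : ℕ} (h : lastWoman sm sw k (l + 1) = 0) :
    edges sm sw k (l + 1) = edges sm sw k l := by
  induction k with
  | zero => ext; simp
  | succ k ih =>
    rw [lastWoman_succ] at h
    rw [edges_succ]
    split_ifs at h ⊢ with h1 h2
    · rfl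
    · rw [ih h, edges_of_lastMan_eq_zero]
      by_contra h3
      exact h2 ⟨h3, .inr h⟩

/-- The last man's edge was created at `(k + 1, x + 1)` on top of `E k x`, and all later columns
kept the matching. This is the traceback step of the output loop. -/
theorem edges_of_lastMan_eq_succ {k l x : ℕ} (h : lastMan sm sw (k + 1) l = x + 1) :
    x < l ∧ edges sm sw (k + 1) l = fun i y => (i = k ∧ y = x) ∨ edges sm sw k x i y := by
  induction l with
  | zero => simp at h
  | succ l ih =>
    rw [lastMan_succ] at h
    rw [edges_succ]
    split_ifs at h ⊢
    · obtain rfl : l = x := by omega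
      exact ⟨by omega, rfl⟩
    · exact ⟨(ih h).1.trans (by omega), (ih h).2⟩

theorem edges_of_lastWoman_eq_succ {k l j : ℕ} (h : lastWoman sm sw k (l + 1) = j + 1) :
    j < k ∧ edges sm sw k (l + 1) = fun i y => (i = j ∧ y = l) ∨ edges sm sw j l i y := by
  induction k with
  | zero => simp at h
  | succ k ih =>
    rw [lastWoman_succ] at h
    rw [edges_succ]
    split_ifs at h ⊢
    · obtain rfl : k = j := by omega
      exact ⟨by omega, rfl⟩
    · exact ⟨(ih h).1.trans (by omega), (ih h).2⟩

/-- Trailing unmatched men can be removed one at a time. -/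
theorem edges_eq_of_forall_man_lt {k l i : ℕ} (hi : i ≤ k)
    (h : ∀ j y, edges sm sw k l j y → j < i) : edges sm sw k l = edges sm sw i l := by
  induction k with
  | zero => rw [Nat.le_zero.mp hi]
  | succ k ih =>
    obtain rfl | hi := hi.eq_or_lt
    · rfl
    have h0 : lastMan sm sw (k + 1) l = 0 := by
      rcases hx : lastMan sm sw (k + 1) l with _ | x
      · rfl
      · have := h k x (by rw [(edges_of_lastMan_eq_succ hx).2]; exact .inl ⟨rfl, rfl⟩)
        omega
    rw [edges_of_lastMan_eq_zero h0] at h ⊢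
    exact ih (by omega) h

theorem edges_eq_of_forall_woman_lt {k l x : ℕ} (hx : x ≤ l)
    (h : ∀ j y, edges sm sw k l j y → y < x) : edges sm sw k l = edges sm sw k x := by
  induction l with
  | zero => rw [Nat.le_zero.mp hx]
  | succ l ih =>
    obtain rfl | hx := hx.eq_or_lt
    · rfl
    have h0 : lastWoman sm sw k (l + 1) = 0 := by
      rcases hj : lastWoman sm sw k (l + 1) with _ | j
      · rfl
      · have := h j l (by rw [(edges_of_lastWoman_eq_succ hj).2]; exact .inl ⟨rfl, rfl⟩)
        omega
    rw [edges_of_lastWoman_eq_zero h0] at h ⊢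
    exact ih (by omega) h

/-- If woman `l` moves from her partner `u` in `E k (l + 1)` to a new man whom she gives the score
`c > sw l u`, and the other edges become `E k l`, then none of the first `k` men blocks with her. -/
theorem not_blocks_column {E : ℕ → ℕ → ℕ → ℕ → Prop} {k l u i c : ℕ}
    (hlt : ∀ k l i x, E k l i x → i < k ∧ x < l)
    (htrim : ∀ i ≤ k, (∀ j y, E k l j y → j < i) → E k l = E i l)
    (hnone : u = 0 → E k (l + 1) = E k l)
    (hsome : ∀ j, u = j + 1 → j < k ∧ E k (l + 1) = fun a y => (a = j ∧ y = l) ∨ E j l a y)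
    (hst : ∀ i x, i < k → x < l + 1 → ¬ Blocks sm sw (E k (l + 1)) i x)
    (hu : sw l u < c) (hi : i < k) (h0 : 0 < sm i (l + 1)) (hc : c < sw l (i + 1))
    (hm : ∀ y, E k l i y → sm i (y + 1) < sm i (l + 1)) (hlast : ∀ j y, E k l j y → j ≤ i) :
    False := by
  -- Such a man would make `(i, l)` block `E k (l + 1)`, since `l` prefers him to `u` as well.
  refine hst i l hi (by omega) ⟨h0, by omega, ?_⟩
  rcases u with _ | j
  · rw [hnone rfl]
    refine ⟨hm, fun j hj => absurd (hlt _ _ _ _ hj).2 (by omega), fun j y hj => ?_⟩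
    have := hlt _ _ _ _ hj
    have := hlast _ _ hj
    omega
  · obtain ⟨hjk, hE⟩ := hsome j rfl
    rw [hE]
    have hij : i ≠ j := by rintro rfl; omega
    -- No edge of `E k l` lies beyond man `i`, so cutting at `j > i` loses nothing and `i` keeps his
    -- partner. If `j < i` instead, man `i` is single in `E k (l + 1)`.
    have hEj : i < j → E k l = E j l := fun h =>
      htrim j hjk.le fun a y ha => (hlast a y ha).trans_lt h
    refine ⟨?_, ?_, ?_⟩
    · rintro y (⟨rfl, -⟩ | h)
      · exact absurd rfl hij
      · have := (hlt _ _ _ _ h).1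
        exact hm y (hEj this ▸ h)
    · rintro a (⟨rfl, -⟩ | h)
      · omega
      · exact absurd (hlt _ _ _ _ h).2 (by omega)
    · rintro a y (⟨rfl, rfl⟩ | h)
      · omega
      · have h1 := hlt _ _ _ _ h
        refine ⟨fun _ => by omega, fun hia => ?_⟩
        have := hlast a y (hEj (by omega) ▸ h)
        omega

theorem Blocks.mono {E F : ℕ → ℕ → Prop} {i x : ℕ} (h : Blocks sm sw E i x)
    (hEF : ∀ j y, F j y → E j y) : Blocks sm sw F i x :=
  ⟨h.1, h.2.1, fun y e => h.2.2.1 y (hEF _ _ e), fun j e => h.2.2.2.1 j (hEF _ _ e),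
    fun j y e => h.2.2.2.2 j y (hEF _ _ e)⟩

/-- Induction on both prefixes along the three cases of the recursion. A pair that lies in the
prefix of the matching kept is excluded by induction; the work concerns pairs that involve an
omitted or newly matched person. -/
theorem not_blocks_edges (hsm : ∀ i, sm i 0 = 0) (hsw : ∀ x, sw x 0 = 0) (k : ℕ) :
    ∀ l i x, i < k → x < l → ¬ Blocks sm sw (edges sm sw k l) i x := by
  induction k with
  | zero => intro l i x hi; omega
  | succ k ihk =>
    intro l
    induction l with
    | zero => intro i x _ hx; omega
    | succ l ihl =>
      intro i x hi hx hb
      rw [edges_succ] at hb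
      split_ifs at hb with hnew hB
      · have hb' : Blocks sm sw (edges sm sw k l) i x := hb.mono fun _ _ => .inr
        obtain ⟨b1, b2, b3, b4, b5⟩ := hb'
        rcases Nat.lt_succ_iff_lt_or_eq.mp hi with hik | rfl <;>
          rcases Nat.lt_succ_iff_lt_or_eq.mp hx with hxl | rfl
        · exact ihk l i x hik hxl ⟨b1, b2, b3, b4, b5⟩
        · refine not_blocks_column (E := edges sm sw) edges_lt
            (fun _ => edges_eq_of_forall_man_lt) edges_of_lastWoman_eq_zero
            (fun _ => edges_of_lastWoman_eq_succ) (ihk (x + 1)) hnew.2 hik b1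
            (hb.2.2.2.1 k (.inl ⟨rfl, rfl⟩)) b3 fun j y hj => ?_
          have := b5 j y hj
          have := edges_lt _ _ _ _ hj
          omega
        -- The same argument with the sexes exchanged. The recursion itself is not symmetric, which
        -- is why `not_blocks_column` takes an abstract family `E` with symmetric structural
        -- properties.
        · refine not_blocks_column (E := fun l k x i => edges sm sw k l i x) (sm := sw) (sw := sm)
            (fun _ _ _ _ h => (edges_lt _ _ _ _ h).symm)
            (fun z hz h => ?_) (fun h => ?_)
            (fun y hy => ⟨(edges_of_lastMan_eq_succ hy).1, ?_⟩)
            (fun z j hz hj hbl => ihl j z hj hz hbl.swap) hnew.1 hxl b2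
            (hb.2.2.1 l (.inl ⟨rfl, rfl⟩)) b4 fun y j hj => ?_
          · ext y j
            rw [edges_eq_of_forall_woman_lt hz fun j y => h y j]
          · ext y j
            rw [edges_of_lastMan_eq_zero h]
          · ext z j
            rw [(edges_of_lastMan_eq_succ hy).2]
            tauto
          · have := b5 j y hj
            have := edges_lt _ _ _ _ hj
            omega
        · exact lt_irrefl _ (hb.2.2.1 x (.inl ⟨rfl, rfl⟩))
      · rcases Nat.lt_succ_iff_lt_or_eq.mp hx with hxl | rfl
        · exact ihl i x hi hxl hb
        obtain ⟨b1, b2, b3, b4, b5⟩ := hb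
        obtain ⟨y, hy⟩ := Nat.exists_eq_succ_of_ne_zero hB.1
        obtain ⟨hyx, hE⟩ := edges_of_lastMan_eq_succ hy
        -- The last man's edge ends above the omitted woman, so it crosses all her pairs with
        -- earlier men; only the corner pair remains.
        have hky : edges sm sw (k + 1) x k y := by rw [hE]; exact .inl ⟨rfl, rfl⟩
        rcases Nat.lt_succ_iff_lt_or_eq.mp hi with hik | rfl
        · have := (b5 k y hky).2 hik
          omega
        · have h1 := b3 y hky
          rw [hy] at hnew
          rcases hB.2 with h | h
          · exact hnew ⟨h1, h⟩
          · rw [h, hsw] at hnew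
            exact hnew ⟨h1, b2⟩
      · rcases Nat.lt_succ_iff_lt_or_eq.mp hi with hik | rfl
        · exact ihk (l + 1) i x hik hx hb
        -- If the last woman is single, so is the last man, and both smaller matchings coincide;
        -- induction then covers his pairs too. Otherwise her edge crosses all his pairs except the
        -- corner.
        rcases hj : lastWoman sm sw i (l + 1) with _ | j
        · have hm : lastMan sm sw (i + 1) l = 0 := by
            by_contra h
            exact hB ⟨h, .inr hj⟩
          rw [edges_of_lastWoman_eq_zero hj, ← edges_of_lastMan_eq_zero hm] at hb
          rcases Nat.lt_succ_iff_lt_or_eq.mp hx with hxl | rfl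
          · exact ihl i x hi hxl hb
          · rw [hm, hj, hsm, hsw] at hnew
            exact hnew ⟨hb.1, hb.2.1⟩
        · obtain ⟨hji, hE⟩ := edges_of_lastWoman_eq_succ hj
          obtain ⟨b1, b2, b3, b4, b5⟩ := hb
          have hjl : edges sm sw i (l + 1) j l := by rw [hE]; exact .inl ⟨rfl, rfl⟩
          rcases Nat.lt_succ_iff_lt_or_eq.mp hx with hxl | rfl
          · have := (b5 j l hjl).1 hji
            omega
          · have h1 := b4 j hjl
            rw [hj] at hnew hB
            have hm : lastMan sm sw (i + 1) x = 0 := by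
              by_contra h
              exact hB ⟨h, .inl h1⟩
            rw [hm, hsm] at hnew
            exact hnew ⟨b1, h1⟩

theorem edges_acceptable (k : ℕ) : ∀ l i x, edges sm sw k l i x →
    0 < sm i (x + 1) ∧ 0 < sw x (i + 1) := by
  induction k with
  | zero => simp
  | succ k ihk =>
    intro l
    induction l with
    | zero => simp
    | succ l ihl =>
      intro i x h
      rw [edges_succ] at h
      split_ifs at h with hnew
      · rcases h with ⟨rfl, rfl⟩ | h
        · omega
        · exact ihk _ _ _ h
      · exact ihl _ _ h
      · exact ihk _ _ _ h

/-- The edges form a strictly increasing chain: they are disjoint and do not cross. -/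
theorem edges_chain (k : ℕ) : ∀ l i x j y, edges sm sw k l i x → edges sm sw k l j y →
    (i < j ↔ x < y) := by
  induction k with
  | zero => simp
  | succ k ihk =>
    intro l
    induction l with
    | zero => simp
    | succ l ihl =>
      intro i x j y h h'
      rw [edges_succ] at h h'
      split_ifs at h h'
      · rcases h with ⟨rfl, rfl⟩ | h <;> rcases h' with ⟨rfl, rfl⟩ | h'
        · simp
        · have := edges_lt _ _ _ _ h'
          omega
        · have := edges_lt _ _ _ _ h
          omega
        · exact ihk _ _ _ _ _ h h'
      · exact ihl _ _ _ _ h h'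
      · exact ihk _ _ _ _ _ h h'

end

@[simp] theorem State.reg_setReg (s : State) (d v r : ℕ) :
    (s.setReg d v).reg r = if r = d then v else s.reg r :=
  Function.update_apply _ _ _ _

@[simp] theorem State.mem_setReg (s : State) (d v : ℕ) : (s.setReg d v).mem = s.mem := rfl

@[simp] theorem State.reg_setMem (s : State) (a v : ℕ) : (s.setMem a v).reg = s.reg := rfl

@[simp] theorem State.mem_setMem (s : State) (a v i : ℕ) :
    (s.setMem a v).mem i = if i = a then v else s.mem i :=
  Function.update_apply _ _ _ _

/-! ### Expressions and their evaluation on the word RAM -/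

/-- Expressions over registers and memory. -/
inductive Expr
  | reg (r : ℕ)
  | num (v : ℕ)
  | bin (o : Op) (a b : Expr)
  | ld (a : Expr)

namespace Expr

instance : Add Expr := ⟨.bin .add⟩
instance : Sub Expr := ⟨.bin .sub⟩
instance : Mul Expr := ⟨.bin .mul⟩
instance : Div Expr := ⟨.bin .div⟩
instance : Mod Expr := ⟨.bin .mod⟩

/-- The value of an expression. -/
def eval (s : State) : Expr → ℕ
  | reg r => s.reg r
  | num v => v
  | bin o a b => o.eval (a.eval s) (b.eval s)
  | ld a => s.mem (a.eval s)

/-- All values that occur in the evaluation of an expression fit into words of `w` bits. -/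
def Fits (w : ℕ) (s : State) : Expr → Prop
  | reg r => s.reg r < 2 ^ w
  | num v => v < 2 ^ w
  | bin o a b => a.Fits w s ∧ b.Fits w s ∧ o.eval (a.eval s) (b.eval s) < 2 ^ w
  | ld a => a.Fits w s ∧ s.mem (a.eval s) < 2 ^ w

/-- A strict upper bound on the registers that occur in an expression. -/
def regBound : Expr → ℕ
  | reg r => r + 1
  | num _ => 0
  | bin _ a b => max a.regBound b.regBound
  | ld a => a.regBound

/-- The number of steps of the evaluation of an expression. -/
def cost : Expr → ℕ
  | reg _ => 2
  | num _ => 1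
  | bin _ a b => a.cost + (b.cost + 1)
  | ld a => a.cost + 1

/-- The program that evaluates an expression into register `d`, and uses larger registers only. -/
def compile : Expr → ℕ → Prog
  -- There is no copy instruction, so the register is added to zero.
  | reg r, d => .seq (.const d 0) (.op .add d d r)
  | num v, d => .const d v
  | bin o a b, d => .seq (a.compile d) (.seq (b.compile (d + 1)) (.op o d d (d + 1)))
  | ld a, d => .seq (a.compile d) (.load d d)

section

variable {w : ℕ} {s s' : State} (a b : Expr)

@[simp] theorem eval_reg (r : ℕ) : (reg r).eval s = s.reg r := rfl
@[simp] theorem eval_num (v : ℕ) : (num v).eval s = v := rfl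
@[simp] theorem eval_add : (a + b).eval s = a.eval s + b.eval s := rfl
@[simp] theorem eval_sub : (a - b).eval s = a.eval s - b.eval s := rfl
@[simp] theorem eval_mul : (a * b).eval s = a.eval s * b.eval s := rfl
@[simp] theorem eval_div : (a / b).eval s = a.eval s / b.eval s := rfl
@[simp] theorem eval_mod : (a % b).eval s = a.eval s % b.eval s := rfl
@[simp] theorem eval_lt : (bin .lt a b).eval s = if a.eval s < b.eval s then 1 else 0 := rfl
@[simp] theorem eval_eq : (bin .eq a b).eval s = if a.eval s = b.eval s then 1 else 0 := rfl
@[simp] theorem eval_ld : (ld a).eval s = s.mem (a.eval s) := rfl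

@[simp] theorem fits_reg (r : ℕ) : (reg r).Fits w s ↔ s.reg r < 2 ^ w := .rfl
@[simp] theorem fits_num (v : ℕ) : (num v).Fits w s ↔ v < 2 ^ w := .rfl
@[simp] theorem fits_add :
    (a + b).Fits w s ↔ a.Fits w s ∧ b.Fits w s ∧ a.eval s + b.eval s < 2 ^ w := .rfl
@[simp] theorem fits_mul :
    (a * b).Fits w s ↔ a.Fits w s ∧ b.Fits w s ∧ a.eval s * b.eval s < 2 ^ w := .rfl
@[simp] theorem fits_ld : (ld a).Fits w s ↔ a.Fits w s ∧ s.mem (a.eval s) < 2 ^ w := .rfl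

variable {a b}

theorem Fits.eval_lt_two_pow (h : a.Fits w s) : a.eval s < 2 ^ w := by
  cases a
  · exact h
  · exact h
  · exact h.2.2
  · exact h.2

variable (a b)

@[simp] theorem fits_sub : (a - b).Fits w s ↔ a.Fits w s ∧ b.Fits w s :=
  ⟨fun h => ⟨h.1, h.2.1⟩, fun h => ⟨h.1, h.2, (Nat.sub_le _ _).trans_lt h.1.eval_lt_two_pow⟩⟩

@[simp] theorem fits_div : (a / b).Fits w s ↔ a.Fits w s ∧ b.Fits w s :=
  ⟨fun h => ⟨h.1, h.2.1⟩, fun h => ⟨h.1, h.2, (Nat.div_le_self _ _).trans_lt h.1.eval_lt_two_pow⟩⟩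

@[simp] theorem fits_mod : (a % b).Fits w s ↔ a.Fits w s ∧ b.Fits w s :=
  ⟨fun h => ⟨h.1, h.2.1⟩, fun h => ⟨h.1, h.2, (Nat.mod_le _ _).trans_lt h.1.eval_lt_two_pow⟩⟩

theorem ite_lt_two_pow_of_ne_zero (hw : w ≠ 0) (p : Prop) [Decidable p] :
    (if p then 1 else 0) < 2 ^ w := by
  have := Nat.one_lt_two_pow hw
  split_ifs <;> omega

theorem fits_lt (hw : w ≠ 0) : (bin .lt a b).Fits w s ↔ a.Fits w s ∧ b.Fits w s :=
  ⟨fun h => ⟨h.1, h.2.1⟩, fun h => ⟨h.1, h.2, ite_lt_two_pow_of_ne_zero hw _⟩⟩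

theorem fits_eq (hw : w ≠ 0) : (bin .eq a b).Fits w s ↔ a.Fits w s ∧ b.Fits w s :=
  ⟨fun h => ⟨h.1, h.2.1⟩, fun h => ⟨h.1, h.2, ite_lt_two_pow_of_ne_zero hw _⟩⟩

variable {a b}

theorem eval_congr {e : Expr} (hm : s'.mem = s.mem) (hr : ∀ r < e.regBound, s'.reg r = s.reg r) :
    e.eval s' = e.eval s := by
  induction e with
  | reg r => exact hr r (Nat.lt_succ_self r)
  | num v => rfl
  | bin o a b iha ihb =>
    simp only [eval, iha fun r h => hr r (lt_max_of_lt_left h),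
      ihb fun r h => hr r (lt_max_of_lt_right h)]
  | ld a iha => simp only [eval, hm, iha hr]

theorem fits_congr {e : Expr} (hm : s'.mem = s.mem) (hr : ∀ r < e.regBound, s'.reg r = s.reg r) :
    e.Fits w s' ↔ e.Fits w s := by
  induction e with
  | reg r => simp only [Fits, hr r (Nat.lt_succ_self r)]
  | num v => rfl
  | bin o a b iha ihb =>
    have ha := fun r h => hr r (lt_max_of_lt_left h)
    have hb := fun r h => hr r (lt_max_of_lt_right h)
    simp only [Fits, iha ha, ihb hb, eval_congr hm ha, eval_congr hm hb]
  | ld a iha => simp only [Fits, hm, iha hr, eval_congr (e := a) hm hr]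

/-- The value of a left operand in `d` survives because the right operand is compiled to `d + 1` and
leaves smaller registers alone. -/
theorem exec_compile {e : Expr} {d : ℕ} (hd : e.regBound ≤ d) (hf : e.Fits w s) :
    ∃ s', Exec w (e.compile d) s e.cost s' ∧ s'.mem = s.mem ∧ s'.reg d = e.eval s ∧
      ∀ r < d, s'.reg r = s.reg r := by
  induction e generalizing d s with
  | reg r =>
    have hrd : r ≠ d := by rintro rfl; exact absurd hd (by simp [regBound])
    have h0 : Op.eval .add ((s.setReg d 0).reg d) ((s.setReg d 0).reg r) = s.reg r := by
      simp [Op.eval, hrd]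
    refine ⟨_, .seq (.const d 0 s (by positivity)) (.op .add d d r _ (by rw [h0]; exact hf)),
      rfl, ?_, fun q hq => ?_⟩
    · rw [h0]; simp [eval]
    · simp [hq.ne]
  | num v =>
    exact ⟨_, .const d v s hf, rfl, by simp [eval],
      fun q hq => by simp [hq.ne]⟩
  | bin o a b iha ihb =>
    obtain ⟨ha, hb⟩ := max_le_iff.mp hd
    obtain ⟨fa, fb, fo⟩ := hf
    obtain ⟨s₁, e₁, m₁, v₁, r₁⟩ := iha ha fa
    have hr₁ : ∀ r < b.regBound, s₁.reg r = s.reg r := fun r hr => r₁ r (hr.trans_le hb)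
    obtain ⟨s₂, e₂, m₂, v₂, r₂⟩ := ihb (d := d + 1) (hb.trans d.le_succ)
      ((fits_congr m₁ hr₁).mpr fb)
    have h0 : o.eval (s₂.reg d) (s₂.reg (d + 1)) = o.eval (a.eval s) (b.eval s) := by
      rw [v₂, r₂ d d.lt_succ_self, v₁, eval_congr m₁ hr₁]
    refine ⟨_, e₁.seq (e₂.seq (.op o d d (d + 1) s₂ (by rw [h0]; exact fo))), m₂.trans m₁, ?_,
      fun q hq => ?_⟩
    · rw [h0]; simp [eval]
    · rw [State.reg_setReg, if_neg hq.ne, r₂ q (hq.trans d.lt_succ_self), r₁ q hq]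
  | ld a iha =>
    obtain ⟨s₁, e₁, m₁, v₁, r₁⟩ := iha hd hf.1
    refine ⟨_, e₁.seq (.load d d s₁), m₁, ?_, fun q hq => ?_⟩
    · simp [eval, v₁, m₁]
    · simp [hq.ne, r₁ q hq]

end

end Expr

/-! ### Verification of programs

Registers below `10` are program variables, the others are used for the evaluation of
expressions. -/

/-- The states agree on memory and on program variables. -/
def State.Agree (s s' : State) : Prop := s.mem = s'.mem ∧ ∀ r < 10, s.reg r = s'.reg r

/-- Started in a state that agrees with `s`, the program `p` halts within `t` steps, in a state that
agrees with a state with the property `Q`. -/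
def Runs (w : ℕ) (p : Prog) (s : State) (t : ℕ) (Q : State → Prop) : Prop :=
  ∀ s₀, s₀.Agree s → ∃ t' ≤ t, ∃ s₁ s', Exec w p s₀ t' s₁ ∧ s₁.Agree s' ∧ Q s'

/-- Assignment of the value of an expression to a variable. -/
def assign (x : ℕ) (e : Expr) : Prog := .seq (e.compile 10) (.seq (.const 11 0) (.op .add x 10 11))

/-- Assignment of the value of the expression `e` to the memory cell with address `a`. -/
def write (a e : Expr) : Prog := .seq (a.compile 10) (.seq (e.compile 11) (.store 10 11))

section

variable {w t t' x r i v : ℕ} {p q : Prog} {s : State} {a e : Expr} {Q R : State → Prop}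

theorem Runs.mono (h : Runs w p s t Q) (ht : t ≤ t') (hQ : ∀ s, Q s → R s) : Runs w p s t' R := by
  intro s₀ h₀
  obtain ⟨u, hu, s₁, s', he, ha, hq⟩ := h s₀ h₀
  exact ⟨u, hu.trans ht, s₁, s', he, ha, hQ _ hq⟩

theorem Runs.skip (h : Q s) : Runs w .skip s 0 Q :=
  fun s₀ h₀ => ⟨0, le_rfl, s₀, s, .skip s₀, h₀, h⟩

theorem Runs.seq (h : Runs w p s t fun s' => Runs w q s' t' Q) :
    Runs w (.seq p q) s (t + t') Q := by
  intro s₀ h₀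
  obtain ⟨u, hu, s₁, s', he, ha, hq⟩ := h s₀ h₀
  obtain ⟨u', hu', s₂, s'', he', ha', hq'⟩ := hq s₁ ha
  exact ⟨u + u', add_le_add hu hu', s₂, s'', he.seq he', ha', hq'⟩

theorem Runs.assign (hb : e.regBound ≤ 10) (hf : e.Fits w s)
    (hv : e.eval s = v)
    (ht : e.cost + 2 ≤ t) (hQ : Q (s.setReg x v)) : Runs w (assign x e) s t Q := by
  subst hv
  intro s₀ h₀
  have hr : ∀ r < e.regBound, s₀.reg r = s.reg r := fun r hr => h₀.2 r (hr.trans_le hb)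
  obtain ⟨s₁, e₁, m₁, v₁, r₁⟩ := Expr.exec_compile hb ((Expr.fits_congr h₀.1 hr).mpr hf)
  rw [Expr.eval_congr h₀.1 hr] at v₁
  have h0 : Op.eval .add ((s₁.setReg 11 0).reg 10) ((s₁.setReg 11 0).reg 11) = e.eval s := by
    simp [Op.eval, v₁]
  refine ⟨e.cost + (1 + 1), ht, _, s.setReg x (e.eval s),
    e₁.seq (.seq (.const 11 0 s₁ (by positivity))
    (.op .add x 10 11 _ (by rw [h0]; exact hf.eval_lt_two_pow))), ⟨m₁.trans h₀.1, fun r hr => ?_⟩,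
    hQ⟩
  rw [h0]
  by_cases hrx : r = x
  · simp [hrx]
  · simp [hrx, show r ≠ 11 by omega, r₁ r hr, h₀.2 r hr]

theorem Runs.write (ha : a.regBound ≤ 10) (hb : e.regBound ≤ 10) (hfa : a.Fits w s)
    (hf : e.Fits w s) (hi : a.eval s = i) (hv : e.eval s = v)
    (ht : a.cost + (e.cost + 1) ≤ t) (hQ : Q (s.setMem i v)) : Runs w (write a e) s t Q := by
  subst hi hv
  intro s₀ h₀
  have hra : ∀ r < a.regBound, s₀.reg r = s.reg r := fun r hr => h₀.2 r (hr.trans_le ha)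
  obtain ⟨s₁, e₁, m₁, v₁, r₁⟩ := Expr.exec_compile ha ((Expr.fits_congr h₀.1 hra).mpr hfa)
  rw [Expr.eval_congr h₀.1 hra] at v₁
  have hr : ∀ r < e.regBound, s₁.reg r = s.reg r := fun r hr =>
    (r₁ r (hr.trans_le hb)).trans (h₀.2 r (hr.trans_le hb))
  have hm := m₁.trans h₀.1
  obtain ⟨s₂, e₂, m₂, v₂, r₂⟩ := Expr.exec_compile (d := 11) (hb.trans (by norm_num))
    ((Expr.fits_congr hm hr).mpr hf)
  rw [Expr.eval_congr hm hr] at v₂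
  refine ⟨a.cost + (e.cost + 1), ht, _, s.setMem (a.eval s) (e.eval s),
    e₁.seq (e₂.seq (.store 10 11 s₂)),
    ⟨?_, fun r h => ?_⟩, hQ⟩
  · simp [State.setMem, m₂, hm, v₂, r₂ 10 (by norm_num), v₁]
  · simp [State.setMem, r₂ r (by omega), r₁ r h, h₀.2 r h]

theorem Runs.ite (hr : r < 10) (h₁ : s.reg r ≠ 0 → Runs w p s t Q)
    (h₂ : s.reg r = 0 → Runs w q s t Q) : Runs w (.ite r p q) s (t + 1) Q := by
  intro s₀ h₀
  by_cases h : s.reg r = 0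
  · obtain ⟨u, hu, s₁, s', he, hh⟩ := h₂ h s₀ h₀
    exact ⟨u + 1, by omega, s₁, s', .ite_false ((h₀.2 r hr).trans h) he, hh⟩
  · obtain ⟨u, hu, s₁, s', he, hh⟩ := h₁ h s₀ h₀
    exact ⟨u + 1, by omega, s₁, s', .ite_true ((h₀.2 r hr).trans_ne h) he, hh⟩

/-- A loop that counts register `r` down to `0`. -/
theorem Runs.countdown {I : ℕ → State → Prop} (hr : r < 10) (hI : ∀ j s, I j s → s.reg r = j)
    (hstep : ∀ j s, I (j + 1) s → Runs w p s t (I j)) (j : ℕ) :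
    ∀ s, I j s → Runs w (.while r p) s ((t + 1) * j + 1) (I 0) := by
  induction j with
  | zero =>
    intro s hs s₀ h₀
    exact ⟨1, by omega, s₀, s, .while_false ((h₀.2 r hr).trans (hI _ _ hs)), h₀, hs⟩
  | succ j ih =>
    intro s hs s₀ h₀
    obtain ⟨u, hu, s₁, s', he, ha, hq⟩ := hstep j s hs s₀ h₀
    obtain ⟨u', hu', s₂, s'', he', ha', hq'⟩ := ih s' hq s₁ ha
    refine ⟨u + u' + 1, ?_, s₂, s'', .while_true ?_ he he', ha', hq'⟩
    · rw [Nat.mul_succ]; omega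
    · rw [h₀.2 r hr, hI _ _ hs]; omega

end

/-! ### The program

With `b = (n + 1) * (n + 1)`, which is kept in register `7`, the memory beyond input and output
holds three tables: the score that person `r` (man `r` or woman `r - n`) gives to the partner coded
by `c`, in cell `3 * b + (r * (n + 1) + c)`; the code of the current partner of woman `l`, in cell
`6 * b + l`; and `lastMan (k + 1) l`, in cell `7 * b + (k * (n + 1) + l)`. -/

/-- The address of entry `x` of row `r` in the table that starts at `c * b`. -/
def entry (c : ℕ) (r x : Expr) : Expr := .num c * .reg 7 + (r * (.reg 0 + .num 1) + x)

/-- The address of the code of the current partner of a woman. -/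
def partner (l : Expr) : Expr := .num 6 * .reg 7 + l

/-- Enter the score given by input cell `a`, where register `1` holds `a + 1`. -/
def scoreBody : Prog :=
  .seq (assign 1 (.reg 1 - .num 1)) <| .seq (assign 4 (.ld (.reg 1))) <|
    -- Reduction modulo `n + 1` sends the null code `n` to column `0`, and the last factor makes the
    -- value written there `0`. The list entry number `k` gets the score `n - k > 0`.
    write (entry 3 (.reg 1 / .reg 0) ((.reg 4 + .num 1) % (.reg 0 + .num 1)))
      ((.reg 0 - .reg 1 % .reg 0) * .bin .lt (.reg 4) (.reg 0))

/-- Update the partners of man `k` and woman `l`, given by registers `2` and `3`. Registers `4` and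
`5` hold the codes of their partners, register `8` whether the woman prefers the man to her partner,
and register `9` whether both prefer each other to their partners. -/
def matchUpdate : Prog :=
  .ite 9
    (.seq (write (entry 7 (.reg 2) (.reg 3 + .num 1)) (.reg 3 + .num 1))
      (write (partner (.reg 3)) (.reg 2 + .num 1)))
    -- Conjunction is a product, disjunction the positivity of a sum. The final `skip` is correct
    -- because the fresh cell still holds `0` and the woman's cell already holds `u`.
    (.seq (assign 9 (.bin .lt (.num 0) (.reg 4) *
        .bin .lt (.num 0) (.reg 8 + .bin .eq (.reg 5) (.num 0))))
      (.ite 9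
        (.seq (write (entry 7 (.reg 2) (.reg 3 + .num 1)) (.reg 4))
          (write (partner (.reg 3)) (.num 0)))
        .skip))

/-- Treat man `k` and woman `l`, where register `1` holds `n * n - (k * n + l)`. -/
def matchBody : Prog :=
  .seq (assign 2 ((.reg 0 * .reg 0 - .reg 1) / .reg 0)) <|
  .seq (assign 3 ((.reg 0 * .reg 0 - .reg 1) % .reg 0)) <|
  .seq (assign 1 (.reg 1 - .num 1)) <|
  .seq (assign 4 (.ld (entry 7 (.reg 2) (.reg 3)))) <|
  .seq (assign 5 (.ld (partner (.reg 3)))) <|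
  .seq (assign 6 (.bin .lt (.ld (entry 3 (.reg 2) (.reg 4)))
    (.ld (entry 3 (.reg 2) (.reg 3 + .num 1))))) <|
  .seq (assign 8 (.bin .lt (.ld (entry 3 (.reg 0 + .reg 3) (.reg 5)))
    (.ld (entry 3 (.reg 0 + .reg 3) (.reg 2 + .num 1))))) <|
  .seq (assign 9 (.reg 6 * .reg 8)) matchUpdate

/-- Output the partner of man `k`, where register `1` holds `k + 1`. Register `3` holds a number `l`
such that the first `k + 1` men have the partners given by `edges sm sw (k + 1) l`. -/
def outputBody : Prog :=
  .seq (assign 1 (.reg 1 - .num 1)) <| .seq (assign 4 (.ld (entry 7 (.reg 1) (.reg 3)))) <|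
  -- Modulo `n + 1`, this turns the internal codes `0` and `y + 1` into the output codes `n` and
  -- `y`.
  .seq (write (.num 2 * (.reg 0 * .reg 0) + .reg 1) ((.reg 4 + .reg 0) % (.reg 0 + .num 1))) <|
    -- Traceback: `l` is kept if the man is single, and becomes his partner otherwise; truncated
    -- subtraction makes the second term vanish in the first case.
    assign 3 (.reg 3 * .bin .eq (.reg 4) (.num 0) + (.reg 4 - .num 1))

/-- The program that finds a weakly stable noncrossing matching. -/
def matchingProgram : Prog :=
  .seq (assign 7 ((.reg 0 + .num 1) * (.reg 0 + .num 1))) <|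
  .seq (assign 1 (.num 2 * (.reg 0 * .reg 0))) <| .seq (.while 1 scoreBody) <|
  .seq (assign 1 (.reg 0 * .reg 0)) <| .seq (.while 1 matchBody) <|
  .seq (assign 3 (.reg 0)) <| .seq (assign 1 (.reg 0)) <| .while 1 outputBody

/-! ### Scores -/

/-- The preference list of man `r`, if `r < n`, and otherwise of woman `r - n`. -/
def prefList {n : ℕ} (I : Profile n) (r : ℕ) : List ℕ :=
  if h : r < n then (I.men ⟨r, h⟩).map Fin.val
  else if h : r - n < n then (I.women ⟨r - n, h⟩).map Fin.val else []

/-- The score that person `r` gives to the partner coded by `c`. -/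
def score {n : ℕ} (I : Profile n) (r c : ℕ) : ℕ :=
  if c ≠ 0 ∧ c - 1 ∈ prefList I r then n - (prefList I r).idxOf (c - 1) else 0

section

variable {n : ℕ} (I : Profile n)

@[simp] theorem score_zero (r : ℕ) : score I r 0 = 0 := by simp [score]

theorem score_le (r c : ℕ) : score I r c ≤ n := by
  unfold score; split_ifs <;> omega

theorem prefList_nodup (r : ℕ) : (prefList I r).Nodup := by
  unfold prefList
  split_ifs
  · exact (I.men_nodup _).map Fin.val_injective
  · exact (I.women_nodup _).map Fin.val_injective
  · exact List.nodup_nil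

theorem lt_of_mem_prefList {r x : ℕ} (h : x ∈ prefList I r) : x < n := by
  unfold prefList at h
  split_ifs at h
  · obtain ⟨y, -, rfl⟩ := List.mem_map.mp h
    exact y.2
  · obtain ⟨y, -, rfl⟩ := List.mem_map.mp h
    exact y.2
  · simp at h

theorem length_prefList_le (r : ℕ) : (prefList I r).length ≤ n := by
  unfold prefList
  split_ifs
  · simpa using (I.men_nodup _).length_le_card
  · simpa using (I.women_nodup _).length_le_card
  · exact Nat.zero_le _

theorem inputMem_eq {a : ℕ} (h : a < 2 * (n * n)) :
    inputMem I a = (prefList I (a / n))[a % n]?.getD n := by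
  have hn : 0 < n := Nat.pos_of_ne_zero (by rintro rfl; simp at h)
  have hcode : ∀ o : Option (Fin n), code o = (o.map Fin.val).getD n := by rintro (_ | _) <;> rfl
  unfold inputMem prefList
  by_cases h1 : a < n * n
  · rw [dif_pos h1, dif_pos (Nat.div_lt_of_lt_mul h1), hcode, List.getElem?_map]
  · have h2 : a - n * n < n * n := by omega
    have h3 : a = a - n * n + n * n := by omega
    have h4 : a / n = (a - n * n) / n + n := by
      conv_lhs => rw [h3, Nat.add_mul_div_left _ _ hn]
    have h5 : a % n = (a - n * n) % n := by
      conv_lhs => rw [h3, Nat.add_mul_mod_self_left]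
    have h6 := Nat.div_lt_of_lt_mul h2
    rw [dif_neg h1, dif_pos h2, hcode, dif_neg (h4 ▸ not_lt.mpr (Nat.le_add_left _ _)),
      dif_pos (by rwa [h4, Nat.add_sub_cancel]),
      List.getElem?_map, h5]
    simp only [h4, Nat.add_sub_cancel]

end

/-! ### Address arithmetic for the tables. -/

theorem mul_add_lt {d m r c : ℕ} (hr : r < m) (hc : c < d) : r * d + c < m * d := by
  calc r * d + c < r * d + d := by omega
    _ = (r + 1) * d := by ring
    _ ≤ m * d := Nat.mul_le_mul_right d hr

theorem mul_add_inj {d r r' c c' : ℕ} (hc : c < d) (hc' : c' < d) :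
    r * d + c = r' * d + c' ↔ r = r' ∧ c = c' := by
  refine ⟨fun h => ?_, by rintro ⟨rfl, rfl⟩; rfl⟩
  rcases lt_trichotomy r r' with hr | rfl | hr
  · have := mul_add_lt hr hc
    omega
  · omega
  · have := mul_add_lt hr hc'
    omega

/-- The size of a table. -/
def block (n : ℕ) : ℕ := (n + 1) * (n + 1)

theorem block_eq (n : ℕ) : block n = n * n + 2 * n + 1 := by unfold block; ring

theorem mul_add_lt_block {n r c : ℕ} (hr : r < n) (hc : c ≤ n) : r * (n + 1) + c < block n :=
  (mul_add_lt hr (Nat.lt_succ_of_le hc)).trans_le (Nat.mul_le_mul_right _ n.le_succ)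

theorem mul_add_lt_two_block {n r c : ℕ} (hr : r < 2 * n) (hc : c ≤ n) :
    r * (n + 1) + c < 2 * block n := by
  have := mul_add_lt hr (Nat.lt_add_one_iff.mpr hc)
  have h2 : 2 * n * (n + 1) = 2 * (n * n) + 2 * n := by ring
  have := block_eq n
  omega

/-! ### Correctness -/

section

variable {n : ℕ} (I : Profile n) {w : ℕ}

/-- The invariant of the computation of the scores, with the input from cell `j` on processed. -/
structure ScoreInv (I : Profile n) (j : ℕ) (s : State) : Prop where
  size : s.reg 0 = n
  side : s.reg 7 = block n
  counter : s.reg 1 = j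
  le : j ≤ 2 * (n * n)
  input : ∀ a < 2 * (n * n), s.mem a = inputMem I a
  scores : ∀ r < 2 * n, ∀ c ≤ n, s.mem (3 * block n + (r * (n + 1) + c)) =
    if j ≤ r * n + (prefList I r).idxOf (c - 1) then score I r c else 0
  zero : ∀ a, 6 * block n ≤ a → s.mem a = 0

theorem scoreBody_runs (hw : 16 * block n ≤ 2 ^ w) (j : ℕ) (s : State)
    (h : ScoreInv I (j + 1) s) : Runs w scoreBody s (100 + (100 + 100)) (ScoreInv I j) := by
  obtain ⟨h0, h7, h1, hj, hin, hsc, hz⟩ := h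
  have hn : 0 < n := Nat.pos_of_ne_zero (by rintro rfl; simp at hj)
  have hb := block_eq n
  have hw0 : w ≠ 0 := by rintro rfl; simp at hw; omega
  have hk : j / n < 2 * n := Nat.div_lt_of_lt_mul (by rw [Nat.mul_left_comm]; exact hj)
  have hl := Nat.mod_lt j hn
  have hdm : j / n * n + j % n = j := by rw [mul_comm]; exact Nat.div_add_mod j n
  have hmem := inputMem_eq I (a := j) hj
  set L := prefList I (j / n) with hL
  have hmn : inputMem I j ≤ n := by
    rw [hmem]
    rcases hx : L[j % n]? with _ | x
    · simp
    · exact (lt_of_mem_prefList I (List.mem_of_getElem? hx)).le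
  have hc : (inputMem I j + 1) % (n + 1) ≤ n := Nat.le_of_lt_succ (Nat.mod_lt _ n.succ_pos)
  have hcell := mul_add_lt_two_block hk hc
  have hv : (n - j % n) * (if inputMem I j < n then 1 else 0) ≤ n := by
    split_ifs <;> omega
  refine .seq (.assign (v := j) (by decide) ?_ ?_ (by decide) ?_)
  · simp [h1]; omega
  · simp [h1]
  refine .seq (.assign (v := inputMem I j) (by decide) ?_ ?_ (by decide) ?_)
  · simp [hin j hj]; omega
  · simp [hin j hj]
  refine .write (by decide) (by decide) ?_ ?_ rfl rfl (by decide) ?_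
  · simp [entry, h0, h7]; omega
  · simp [Expr.fits_lt _ _ hw0, h0]; split_ifs <;> omega
  simp only [entry, Expr.eval_add, Expr.eval_mul, Expr.eval_num, Expr.eval_reg, Expr.eval_div,
    Expr.eval_mod, Expr.eval_sub, Expr.eval_lt, State.reg_setReg, h0, h7, reduceIte,
    OfNat.ofNat_ne_one, OfNat.zero_ne_ofNat, zero_ne_one, OfNat.one_ne_ofNat, Nat.reduceEqDiff]
  refine ⟨by simp [h0], by simp [h7], by simp, by omega, fun a ha => ?_, fun r hr c hcn => ?_,
    fun a ha => ?_⟩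
  · rw [State.mem_setMem, if_neg (by omega)]
    exact hin a ha
  · have hcell' := mul_add_lt_two_block hr hcn
    have hs := hsc r hr c hcn
    have hiff : r * (n + 1) + c = j / n * (n + 1) + (inputMem I j + 1) % (n + 1) ↔ _ :=
      mul_add_inj (Nat.lt_add_one_iff.mpr hcn) (Nat.lt_add_one_iff.mpr hc)
    -- A nonzero score whose source is input cell `j` can only belong to the entry written now.
    have hkey : score I r c ≠ 0 → r * n + (prefList I r).idxOf (c - 1) = j →
        r = j / n ∧ c ≠ 0 ∧ L[j % n]? = some (c - 1) := by
      intro h1 h2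
      have h3 : c ≠ 0 ∧ c - 1 ∈ prefList I r := by
        by_contra h
        exact h1 (if_neg h)
      have h4 := List.idxOf_lt_length_of_mem h3.2
      obtain ⟨rfl, h5⟩ := (mul_add_inj (h4.trans_le (length_prefList_le I r)) hl).mp
        (h2.trans hdm.symm)
      refine ⟨rfl, h3.1, ?_⟩
      rw [hL, ← h5, List.getElem?_eq_getElem h4, List.getElem_idxOf]
    simp only [State.mem_setMem, State.mem_setReg, Nat.add_left_cancel_iff, hiff]
    rcases hx : L[j % n]? with _ | x
    · have hin : inputMem I j = n := by rw [hmem, hx]; rfl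
      rw [hin, Nat.mod_self, if_neg (lt_irrefl n), mul_zero]
      by_cases hsc0 : score I r c = 0
      · simp [hs, hsc0]
      have h1 : r * n + (prefList I r).idxOf (c - 1) ≠ j := fun h => by
        simpa [hx] using (hkey hsc0 h).2.2
      have h2 : c ≠ 0 := by rintro rfl; exact hsc0 (score_zero I r)
      rw [if_neg fun h => h2 h.2, hs]
      split_ifs <;> first | rfl | omega
    · have hin : inputMem I j = x := by rw [hmem, hx]; rfl
      have hxL := List.mem_of_getElem? hx
      have hxn := lt_of_mem_prefList I hxL
      rw [hin, Nat.mod_eq_of_lt (by omega), if_pos hxn, mul_one]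
      split_ifs with h1 h2 h2
      · obtain ⟨rfl, rfl⟩ := h1
        obtain ⟨h3, h4⟩ := List.getElem?_eq_some_iff.mp hx
        rw [score, if_pos ⟨by omega, hxL⟩, Nat.add_sub_cancel, ← h4,
          (prefList_nodup I _).idxOf_getElem]
      · obtain ⟨rfl, rfl⟩ := h1
        obtain ⟨h3, h4⟩ := List.getElem?_eq_some_iff.mp hx
        rw [Nat.add_sub_cancel, ← h4, (prefList_nodup I _).idxOf_getElem] at h2
        omega
      · by_cases hsc0 : score I r c = 0
        · simp [hs, hsc0]
        rw [hs, if_pos]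
        by_contra h3
        obtain ⟨h4, h5, h6⟩ := hkey hsc0 (by omega)
        rw [hx, Option.some_inj] at h6
        exact h1 ⟨h4, by omega⟩
      · rw [hs, if_neg (by omega)]
  · rw [State.mem_setMem, if_neg (by omega)]
    exact hz a ha

end

section

variable {sm sw : ℕ → ℕ → ℕ}

theorem lastMan_le (k l : ℕ) : lastMan sm sw k l ≤ l := by
  cases k with
  | zero => simp
  | succ k =>
    rcases h : lastMan sm sw (k + 1) l with _ | x
    · exact Nat.zero_le _
    · exact (edges_of_lastMan_eq_succ h).1

theorem lastWoman_le (k l : ℕ) : lastWoman sm sw k (l + 1) ≤ k := by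
  rcases h : lastWoman sm sw k (l + 1) with _ | j
  · exact Nat.zero_le _
  · exact (edges_of_lastWoman_eq_succ h).1

end

/-! ### Filling the table of partners. -/

section

variable {n : ℕ} (I : Profile n) {w : ℕ}

/-- The score that woman `x` gives to the partner coded by `c`. -/
def womanScore (x c : ℕ) : ℕ := score I (n + x) c

/-- The invariant of the computation of the partners, with `j` pairs of a man and a woman left. -/
structure MatchInv (j : ℕ) (s : State) : Prop where
  size : s.reg 0 = n
  side : s.reg 7 = block n
  counter : s.reg 1 = j
  le : j ≤ n * n
  scores : ∀ r < 2 * n, ∀ c ≤ n, s.mem (3 * block n + (r * (n + 1) + c)) =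
    score I r c
  men : ∀ k < n, ∀ l ≤ n, s.mem (7 * block n + (k * (n + 1) + l)) =
    if k * n + l + j ≤ n * n then
      lastMan (score I) (womanScore I) (k + 1) l else 0
  women : ∀ k, ∀ l < n, n * n ≤ k * n + l + j → k * n + l + j < n * n + n →
    s.mem (6 * block n + l) =
      lastWoman (score I) (womanScore I) k (l + 1)

variable {I}

theorem MatchInv.update {j k l : ℕ} {s s' : State} (h : MatchInv I (j + 1) s) (hk : k < n)
    (hl : l < n) (hj : k * n + l + (j + 1) = n * n) (h0 : s'.reg 0 = n) (h7 : s'.reg 7 = block n)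
    (h1 : s'.reg 1 = j)
    (hman : s'.mem (7 * block n + (k * (n + 1) + (l + 1))) =
      lastMan (score I) (womanScore I) (k + 1) (l + 1))
    (hwoman : s'.mem (6 * block n + l) =
      lastWoman (score I) (womanScore I) (k + 1) (l + 1))
    (hmem : ∀ a, a ≠ 7 * block n + (k * (n + 1) + (l + 1)) →
      a ≠ 6 * block n + l → s'.mem a = s.mem a) : MatchInv I j s' := by
  have hb := block_eq n
  refine ⟨h0, h7, h1, by omega, fun r hr c hc => ?_, fun k' hk' l' hl' => ?_,
    fun k' l' hl' h2 h3 => ?_⟩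
  · have := mul_add_lt_two_block hr hc
    rw [hmem _ (by omega) (by omega)]
    exact h.scores r hr c hc
  · have hinj : k' * (n + 1) + l' = k * (n + 1) + (l + 1) ↔ _ :=
      mul_add_inj (Nat.lt_add_one_iff.mpr hl') (Nat.lt_add_one_iff.mpr hl)
    by_cases he : k' = k ∧ l' = l + 1
    · obtain ⟨rfl, rfl⟩ := he
      rw [hman, if_pos (by omega)]
    · rw [hmem _ (by rwa [Ne, Nat.add_left_cancel_iff, hinj]) (by omega), h.men k' hk' l' hl']
      rcases l' with _ | l'
      · simp
      · have hne : k' * n + l' ≠ k * n + l := by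
          rw [Ne, mul_add_inj (by omega) hl]
          omega
        split_ifs <;> first | rfl | omega
  · by_cases he : l' = l
    · subst he
      -- The window of `n` consecutive pair indices in `MatchInv.women` contains exactly one pair of
      -- each column; for column `l` it has just moved on to row `k + 1`.
      have hkk : k' = k + 1 := by
        have h4 : (k + 1) * n = k * n + n := by ring
        refine Nat.eq_of_mul_eq_mul_right (show 0 < n by omega) ?_
        have h5 : k * n < k' * n := by omega
        have h6 : k + 1 ≤ k' := lt_of_mul_lt_mul_right h5 (Nat.zero_le _)
        have h7 := Nat.mul_le_mul_right n h6
        omega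
      rw [hwoman, hkk]
    · have hne : k' * n + l' ≠ (k + 1) * n + l := by
        rw [Ne, mul_add_inj hl' hl]
        omega
      have h4 : (k + 1) * n = k * n + n := by ring
      rw [hmem _ (by omega) (by omega)]
      exact h.women k' l' hl' (by omega) (by omega)

theorem matchUpdate_runs (hw : 16 * block n ≤ 2 ^ w) {j k l : ℕ} {s s₀ : State}
    (hs₀ : MatchInv I (j + 1) s₀) (hk : k < n) (hl : l < n)
    (hj : k * n + l + (j + 1) = n * n) (hmem : s.mem = s₀.mem) (h0 : s.reg 0 = n)
    (h1 : s.reg 1 = j) (h7 : s.reg 7 = block n) (h2 : s.reg 2 = k) (h3 : s.reg 3 = l)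
    (h4 : s.reg 4 = lastMan (score I) (womanScore I) (k + 1) l)
    (h5 : s.reg 5 = lastWoman (score I) (womanScore I) k (l + 1))
    (h8 : s.reg 8 = if womanScore I l (s.reg 5) < womanScore I l (k + 1) then 1 else 0)
    (h9 : s.reg 9 = if score I k (s.reg 4) < score I k (l + 1) ∧
      womanScore I l (s.reg 5) < womanScore I l (k + 1) then 1 else 0) :
    Runs w matchUpdate s (100 + (100 + 100 + 1) + 1) (MatchInv I j) := by
  have hb := block_eq n
  have hw0 : w ≠ 0 := by rintro rfl; simp at hw; omega
  have hcell := mul_add_lt_block hk (Nat.succ_le_of_lt hl)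
  have hm : s.reg 4 ≤ l := h4 ▸ lastMan_le _ _
  have hu : s.reg 5 ≤ k := h5 ▸ lastWoman_le _ _
  have hman := lastMan_succ (sm := score I) (sw := womanScore I) k l
  have hwoman := lastWoman_succ (sm := score I) (sw := womanScore I) k l
  rw [← h4, ← h5] at hman hwoman
  refine .ite (by decide) (fun h => ?_) (fun h => ?_)
  · rw [h9] at h
    have hc := by_contra fun hc => h (if_neg hc)
    rw [if_pos hc] at hman hwoman
    refine Runs.mono (t := 100 + 100) (Q := MatchInv I j) ?_ (by norm_num) fun _ => id
    refine .seq (.write (i := 7 * block n + (k * (n + 1) + (l + 1))) (v := l + 1) (by decide)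
      (by decide) ?_ ?_ ?_ ?_ (by decide) ?_)
    · simp [entry, h0, h7, h2, h3]; omega
    · simp [h3]; omega
    · simp [entry, h0, h7, h2, h3]
    · simp [h3]
    refine .write (i := 6 * block n + l) (v := k + 1) (by decide)
      (by decide) ?_ ?_ ?_ ?_ (by decide) ?_
    · simp [partner, h7, h3]; omega
    · simp [h2]; omega
    · simp [partner, h7, h3]
    · simp [h2]
    refine hs₀.update hk hl hj (by simpa using h0) (by simpa using h7) (by simpa using h1) ?_ ?_ ?_
    · rw [State.mem_setMem, if_neg (by omega), State.mem_setMem, if_pos rfl, hman]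
    · rw [State.mem_setMem, if_pos rfl, hwoman]
    · intro a h1 h2
      rw [State.mem_setMem, if_neg h2, State.mem_setMem, if_neg h1, hmem]
  · rw [h9] at h
    have hc : ¬ _ := fun hc => one_ne_zero ((if_pos hc).symm.trans h)
    have h8' : womanScore I l (s.reg 5) < womanScore I l (k + 1) ↔ s.reg 8 ≠ 0 := by
      rw [h8]
      split_ifs with hp <;> simp [hp]
    have hle : s.reg 8 ≤ 1 := by
      rw [h8]
      split_ifs <;> norm_num
    clear h8
    rw [if_neg hc] at hman hwoman
    simp only [h8'] at hman hwoman
    refine .seq (.assign (v := if s.reg 4 ≠ 0 ∧ (s.reg 8 ≠ 0 ∨ s.reg 5 = 0) then 1 else 0)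
      (by decide) ?_ ?_ (by decide) ?_)
    · by_cases h40 : s.reg 4 = 0 <;> by_cases h50 : s.reg 5 = 0 <;>
        simp [Expr.fits_lt _ _ hw0, Expr.fits_eq _ _ hw0, Nat.pos_iff_ne_zero, h40, h50] <;>
        (try split_ifs) <;> omega
    · by_cases h40 : s.reg 4 = 0 <;> by_cases h50 : s.reg 5 = 0 <;>
        simp [Nat.pos_iff_ne_zero, h40, h50]
    refine .ite (by decide) (fun h => ?_) (fun h => ?_)
    · simp only [State.reg_setReg, if_true] at h
      have hc := by_contra fun hc => h (if_neg hc)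
      rw [if_pos hc] at hman hwoman
      refine Runs.mono (t := 100 + 100) (Q := MatchInv I j) ?_ (by norm_num) fun _ => id
      refine .seq (.write (i := 7 * block n + (k * (n + 1) + (l + 1))) (v := s.reg 4) (by decide)
        (by decide) ?_ ?_ ?_ ?_ (by decide) ?_)
      · simp [entry, h0, h7, h2, h3]; omega
      · simp; omega
      · simp [entry, h0, h7, h2, h3]
      · simp
      refine .write (i := 6 * block n + l) (v := 0) (by decide)
        (by decide) ?_ ?_ ?_ ?_ (by decide) ?_
      · simp [partner, h7, h3]; omega
      · simp
      · simp [partner, h7, h3]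
      · simp
      refine hs₀.update hk hl hj (by simpa using h0) (by simpa using h7) (by simpa using h1)
        ?_ ?_ ?_
      · rw [State.mem_setMem, if_neg (by omega), State.mem_setMem, if_pos rfl, hman]
      · rw [State.mem_setMem, if_pos rfl, hwoman]
      · intro a h1 h2
        rw [State.mem_setMem, if_neg h2, State.mem_setMem, if_neg h1, State.mem_setReg, hmem]
    · simp only [State.reg_setReg, if_true] at h
      have hc : ¬ _ := fun hc => one_ne_zero ((if_pos hc).symm.trans h)
      rw [if_neg hc] at hman hwoman
      refine (Runs.skip ?_).mono (Nat.zero_le _) fun _ => id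
      refine hs₀.update hk hl hj (by simpa using h0) (by simpa using h7) (by simpa using h1)
        ?_ ?_ ?_
      · rw [State.mem_setReg, hmem, hs₀.men k hk (l + 1) hl, if_neg (by omega), hman]
      · rw [State.mem_setReg, hmem, hs₀.women k l hl (by omega) (by omega), hwoman, h5]
      · intro a h1 h2
        rw [State.mem_setReg, hmem]

theorem matchBody_runs (hw : 16 * block n ≤ 2 ^ w) (j : ℕ) (s : State)
    (h : MatchInv I (j + 1) s) : Runs w matchBody s
      (100 + (100 + (100 + (100 + (100 + (100 + (100 + (100 + (100 + (100 + 100 + 1) + 1)))))))))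
      (MatchInv I j) := by
  have hb := block_eq n
  have hjn := h.le
  have hn : 0 < n := Nat.pos_of_ne_zero (by rintro rfl; simp at hjn)
  have hw0 : w ≠ 0 := by rintro rfl; simp at hw; omega
  obtain ⟨k, hkdef⟩ : ∃ k, (n * n - (j + 1)) / n = k := ⟨_, rfl⟩
  obtain ⟨l, hldef⟩ : ∃ l, (n * n - (j + 1)) % n = l := ⟨_, rfl⟩
  have hk : k < n := hkdef ▸ Nat.div_lt_of_lt_mul (by omega)
  have hl : l < n := hldef ▸ Nat.mod_lt _ hn
  have hj : k * n + l + (j + 1) = n * n := by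
    have := Nat.div_add_mod (n * n - (j + 1)) n
    rw [hkdef, hldef, mul_comm] at this
    omega
  have hman := h.men k hk l hl.le
  rw [if_pos hj.le] at hman
  have hwoman := h.women k l hl (by omega) (by omega)
  obtain ⟨m, hm⟩ : ∃ m, lastMan (score I) (womanScore I) (k + 1) l = m := ⟨_, rfl⟩
  obtain ⟨u, hu⟩ : ∃ u, lastWoman (score I) (womanScore I) k (l + 1) = u := ⟨_, rfl⟩
  have hml : m ≤ l := hm ▸ lastMan_le _ _
  have huk : u ≤ k := hu ▸ lastWoman_le _ _
  rw [hm] at hman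
  rw [hu] at hwoman
  have hc1 := mul_add_lt_block hk hl.le
  have hc2 := mul_add_lt_block hk (hml.trans hl.le)
  have hc3 := mul_add_lt_block hk (Nat.succ_le_of_lt hl)
  have hnl : n + l < 2 * n := by omega
  have hc4 := mul_add_lt_two_block hnl (huk.trans hk.le)
  have hc5 := mul_add_lt_two_block hnl (Nat.succ_le_of_lt hk)
  have hs1 := h.scores k (by omega) m (hml.trans hl.le)
  have hs2 := h.scores k (by omega) (l + 1) hl
  have hs3 : _ = womanScore I l u := h.scores (n + l) hnl u (huk.trans hk.le)
  have hs4 : _ = womanScore I l (k + 1) := h.scores (n + l) hnl (k + 1) hk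
  have hb1 := score_le I k m
  have hb2 := score_le I k (l + 1)
  have hb3 : womanScore I l u ≤ n := score_le I _ _
  have hb4 : womanScore I l (k + 1) ≤ n := score_le I _ _
  have h0 := h.size
  have h1 := h.counter
  have h7 := h.side
  refine .seq (.assign (v := k) (by decide) ?_ ?_ (by decide) ?_)
  · simp [h0, h1]; omega
  · simpa [h0, h1] using hkdef
  refine .seq (.assign (v := l) (by decide) ?_ ?_ (by decide) ?_)
  · simp [h0, h1]; omega
  · simpa [h0, h1] using hldef
  refine .seq (.assign (v := j) (by decide) ?_ ?_ (by decide) ?_)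
  · simp [h1]; omega
  · simp [h1]
  refine .seq (.assign (v := m) (by decide) ?_ ?_ (by decide) ?_)
  · simp [entry, h0, h7, hman]; omega
  · simp [entry, h0, h7, hman]
  refine .seq (.assign (v := u) (by decide) ?_ ?_ (by decide) ?_)
  · simp [partner, h7, hwoman]; omega
  · simp [partner, h7, hwoman]
  refine .seq (.assign (v := if score I k m < score I k (l + 1) then 1 else 0) (by decide) ?_ ?_
    (by decide) ?_)
  · simp [entry, Expr.fits_lt _ _ hw0, h0, h7, hs1, hs2]; omega
  · simp [entry, h0, h7, hs1, hs2]
  refine .seq (.assign (v := if womanScore I l u < womanScore I l (k + 1) then 1 else 0)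
    (by decide) ?_ ?_ (by decide) ?_)
  · simp [entry, Expr.fits_lt _ _ hw0, h0, h7, hs3, hs4]; omega
  · simp [entry, h0, h7, hs3, hs4]
  refine .seq (.assign (v := if score I k m < score I k (l + 1) ∧
    womanScore I l u < womanScore I l (k + 1) then 1 else 0) (by decide) ?_ ?_ (by decide) ?_)
  · simp; split_ifs <;> omega
  · simp; split_ifs <;> simp_all
  exact matchUpdate_runs hw h hk hl hj rfl (by simp [h0]) (by simp) (by simp [h7]) (by simp)
    (by simp) (by simp [hm]) (by simp [hu]) (by simp) (by simp)

end

/-! ### Tracing back and writing the output. -/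

section

variable {n : ℕ} (I : Profile n) {w : ℕ}

/-- The edges of the matching that the program computes. -/
def result : ℕ → ℕ → Prop := edges (score I) (womanScore I) n n

/-- The invariant of the output of the partners, with the first `j` men left. -/
structure OutputInv (j : ℕ) (s : State) : Prop where
  size : s.reg 0 = n
  side : s.reg 7 = block n
  counter : s.reg 1 = j
  le : j ≤ n
  women_le : s.reg 3 ≤ n
  men : ∀ k < n, ∀ l ≤ n, s.mem (7 * block n + (k * (n + 1) + l)) =
    lastMan (score I) (womanScore I) (k + 1) l
  rest : ∀ i < j, ∀ x, result I i x ↔ edges (score I) (womanScore I) j (s.reg 3) i x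
  output : ∀ i, j ≤ i → i < n → (s.mem (2 * (n * n) + i) = n ∧ ∀ x, ¬ result I i x) ∨
    result I i (s.mem (2 * (n * n) + i))

variable {I}

theorem outputBody_runs (hw : 16 * block n ≤ 2 ^ w) (j : ℕ) (s : State)
    (h : OutputInv I (j + 1) s) :
    Runs w outputBody s (100 + (100 + (100 + 100))) (OutputInv I j) := by
  obtain ⟨h0, h7, h1, hj, hl, hmen, hrest, hout⟩ := h
  have hb := block_eq n
  have hw0 : w ≠ 0 := by rintro rfl; simp at hw; omega
  obtain ⟨l, h3⟩ : ∃ l, s.reg 3 = l := ⟨_, rfl⟩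
  rw [h3] at hl hrest
  have hman := hmen j hj l hl
  obtain ⟨m, hm⟩ : ∃ m, lastMan (score I) (womanScore I) (j + 1) l = m := ⟨_, rfl⟩
  rw [hm] at hman
  have hml : m ≤ l := hm ▸ lastMan_le _ _
  have hc := mul_add_lt_block hj hl
  have hv : (m + n) % (n + 1) ≤ n := Nat.le_of_lt_succ (Nat.mod_lt _ n.succ_pos)
  refine .seq (.assign (v := j) (by decide) ?_ ?_ (by decide) ?_)
  · simp [h1]; omega
  · simp [h1]
  refine .seq (.assign (v := m) (by decide) ?_ ?_ (by decide) ?_)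
  · simp [entry, h0, h3, h7, hman]; omega
  · simp [entry, h0, h3, h7, hman]
  refine .seq (.write (i := 2 * (n * n) + j) (v := (m + n) % (n + 1)) (by decide)
    (by decide) ?_ ?_ ?_ ?_ (by decide) ?_)
  · simp [h0]; omega
  · simp [h0]; omega
  · simp [h0]
  · simp [h0]
  refine .assign (v := if m = 0 then l else m - 1) (by decide) ?_ ?_ (by decide) ?_
  · simp [Expr.fits_eq _ _ hw0, h3]
    split_ifs <;> omega
  · simp [h3]
    split_ifs <;> omega
  refine ⟨by simpa using h0, by simpa using h7, by simp, by omega, ?_, fun k hk l' hl' => ?_, ?_,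
    fun i hi hin => ?_⟩
  · simp only [State.reg_setReg, if_true]
    split_ifs <;> omega
  · rw [State.mem_setReg, State.mem_setMem, if_neg (by omega)]
    exact hmen k hk l' hl'
  · intro i hi x
    rw [hrest i (by omega) x, State.reg_setReg, if_pos rfl]
    rcases m with _ | y
    · rw [edges_of_lastMan_eq_zero hm, if_pos rfl]
    · rw [(edges_of_lastMan_eq_succ hm).2, if_neg (Nat.succ_ne_zero y), Nat.add_sub_cancel]
      exact ⟨fun h => h.resolve_left (by omega), .inr⟩
  · rw [State.mem_setReg, State.mem_setMem]
    split_ifs with hij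
    · obtain rfl : i = j := by omega
      rcases m with _ | y
      · left
        refine ⟨by rw [zero_add, Nat.mod_eq_of_lt n.lt_succ_self], fun x hx => ?_⟩
        rw [hrest i i.lt_succ_self, edges_of_lastMan_eq_zero hm] at hx
        exact lt_irrefl i (edges_lt _ _ _ _ hx).1
      · right
        rw [show y + 1 + n = y + (n + 1) by ring, Nat.add_mod_right, Nat.mod_eq_of_lt (by omega),
          hrest i i.lt_succ_self, (edges_of_lastMan_eq_succ hm).2]
        exact .inl ⟨rfl, rfl⟩
    · exact hout i (by omega) hin

theorem matchingProgram_runs (hw : 16 * block n ≤ 2 ^ w) :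
    Runs w matchingProgram (initState I) (10000 * (n * n + 1)) (OutputInv I 0) := by
  have hb := block_eq n
  have hnn := Nat.le_mul_self n
  have hw0 : w ≠ 0 := by rintro rfl; simp at hw; omega
  have hdef : (n + 1) * (n + 1) = block n := rfl
  refine Runs.mono (t := 100 + (100 + (((100 + (100 + 100)) + 1) * (2 * (n * n)) + 1 + (100 +
    (((100 + (100 + (100 + (100 + (100 + (100 + (100 + (100 +
      (100 + (100 + 100 + 1) + 1))))))))) + 1) * (n * n) + 1 +
    (100 + (100 + (((100 + (100 + (100 + 100))) + 1) * n + 1))))))))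
    (Q := OutputInv I 0) ?_ (by omega) fun _ => id
  have hinit (a : ℕ) (ha : 2 * (n * n) ≤ a) : inputMem I a = 0 := by
    rw [inputMem, dif_neg (by omega), dif_neg (by omega)]
  refine .seq (.assign (v := block n) (by decide) ?_ ?_ (by decide) ?_)
  · simp [initState, hdef]; omega
  · simp [initState, hdef]
  refine .seq (.assign (v := 2 * (n * n)) (by decide) ?_ ?_ (by decide) ?_)
  · simp [initState]; omega
  · simp [initState]
  refine .seq ((Runs.countdown (by decide) (fun _ _ h => h.counter) (scoreBody_runs I hw)
    (2 * (n * n)) _ ?_).mono le_rfl fun s h => ?_)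
  · refine ⟨by simp [initState], by simp, by simp, le_rfl, fun _ _ => rfl,
      fun r hr c hc => ?_, fun a ha => hinit a (by omega)⟩
    rw [State.mem_setReg, State.mem_setReg]
    -- Before the loop only an absent partner can have a position past the end of the input, and
    -- that partner's score is `0`.
    refine (hinit _ (by omega)).trans (Eq.symm ?_)
    rw [ite_eq_right_iff]
    intro h
    refine if_neg fun h' => ?_
    have h1 := (List.idxOf_lt_length_of_mem h'.2).trans_le (length_prefList_le I r)
    have h2 := mul_add_lt hr h1
    have h3 : 2 * n * n = 2 * (n * n) := by ring
    omega
  have hs := h.scores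
  refine .seq (.assign (v := n * n) (by decide) ?_ ?_ (by decide) ?_)
  · simp [h.size]; omega
  · simp [h.size]
  refine .seq ((Runs.countdown (by decide) (fun _ _ h => h.counter) (matchBody_runs (I := I) hw)
    (n * n) _ ?_).mono le_rfl fun s h => ?_)
  · refine ⟨by simpa using h.size, by simpa using h.side, by simp, le_rfl, fun r hr c hc => ?_,
      fun k hk l hl => ?_, fun k l hl h1 h2 => ?_⟩
    · rw [State.mem_setReg, hs r hr c hc, if_pos (Nat.zero_le _)]
    · rw [State.mem_setReg, h.zero _ (by omega), eq_comm, ite_eq_right_iff]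
      intro h1
      -- Before the loop only column `0` counts as filled, and the initial zeros are right for it.
      rw [show l = 0 by omega, lastMan_zero_right]
    · have hk : k = 0 := by
        by_contra hk
        have := Nat.mul_le_mul_right n (Nat.one_le_iff_ne_zero.mpr hk)
        omega
      rw [State.mem_setReg, h.zero _ (by omega), hk, lastWoman_zero_left]
  refine .seq (.assign (v := n) (by decide) ?_ ?_ (by decide) ?_)
  · simp [h.size]; omega
  · simp [h.size]
  refine .seq (.assign (v := n) (by decide) ?_ ?_ (by decide) ?_)
  · simp [h.size]; omega
  · simp [h.size]
  refine Runs.countdown (by decide) (fun _ _ h => h.counter) (outputBody_runs (I := I) hw)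
    n _ ⟨by simpa using h.size, by simpa using h.side, by simp, le_rfl, by simp,
      fun k hk l hl => ?_, fun i hi x => ?_, fun i h1 h2 => absurd h1 h2.not_ge⟩
  · rw [State.mem_setReg, State.mem_setReg, h.men k hk l hl, if_pos]
    have := mul_add_lt (d := n + 1) hk (Nat.lt_succ_of_le hl)
    have h4 : (k + 1) * n = k * n + n := by ring
    have h5 := Nat.mul_le_mul_right n (Nat.succ_le_of_lt hk)
    rw [Nat.succ_eq_add_one] at h5
    omega
  · simp [result]

/-! ### The matching -/

open Classical in
/-- The partner in a relation, if there is one. -/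
noncomputable def partnerOf (R : Fin n → Fin n → Prop) (i : Fin n) : Option (Fin n) :=
  if h : ∃ x, R i x then some h.choose else none

theorem partnerOf_eq_some {R : Fin n → Fin n → Prop} (hR : ∀ i x y, R i x → R i y → x = y)
    {i x : Fin n} : partnerOf R i = some x ↔ R i x := by
  unfold partnerOf
  split_ifs with h
  · rw [Option.some_inj]
    exact ⟨fun h' => h' ▸ h.choose_spec, hR _ _ _ h.choose_spec⟩
  · exact ⟨fun h' => by simp at h', fun h' => absurd ⟨x, h'⟩ h⟩

variable (I)

theorem result_right_unique (i x y : Fin n) (h : result I i x) (h' : result I i y) : x = y := by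
  have h1 := edges_chain _ _ _ _ _ _ h h'
  have h2 := edges_chain _ _ _ _ _ _ h' h
  omega

theorem result_left_unique (x i j : Fin n) (h : result I i x) (h' : result I j x) : i = j := by
  have h1 := edges_chain _ _ _ _ _ _ h h'
  have h2 := edges_chain _ _ _ _ _ _ h' h
  omega

/-- The matching that the program computes. -/
noncomputable def resultMatching : Matching n where
  toFun := partnerOf fun i x => result I i x
  invFun := partnerOf fun x i => result I i x
  inv i x := by
    rw [partnerOf_eq_some (result_left_unique I),
      partnerOf_eq_some (result_right_unique I)]

theorem resultMatching_eq_some {i x : Fin n} : resultMatching I i = some x ↔ result I i x :=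
  partnerOf_eq_some (result_right_unique I)

theorem resultMatching_symm_eq_some {i x : Fin n} :
    (resultMatching I).symm x = some i ↔ result I i x :=
  partnerOf_eq_some (result_left_unique I)

theorem outputs_resultMatching {s : State} (h : OutputInv I 0 s) :
    Outputs s (resultMatching I) := by
  intro i
  rcases h.output i (Nat.zero_le _) i.2 with ⟨h1, h2⟩ | h1
  · rcases hx : resultMatching I i with _ | x
    · exact h1
    · exact absurd ((resultMatching_eq_some I).mp hx) (h2 x)
  · have h2 := (edges_lt _ _ _ _ h1).2
    rw [(resultMatching_eq_some I (x := ⟨_, h2⟩)).mpr h1]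
    rfl

variable {I}

/-! ### Scores represent the preferences. -/

theorem idxOf_map_val (P : List (Fin n)) (x : Fin n) :
    (P.map Fin.val).idxOf (x : ℕ) = P.idxOf x := by
  induction P with
  | nil => rfl
  | cons a P ih =>
    simp only [List.map_cons, List.idxOf_cons, ih, beq_iff_eq, Fin.val_inj, Bool.cond_eq_ite]

theorem prefList_man (i : Fin n) : prefList I i = (I.men i).map Fin.val := by
  rw [prefList, dif_pos i.2]

theorem prefList_woman (x : Fin n) : prefList I (n + x) = (I.women x).map Fin.val := by
  simp [prefList]

theorem score_eq {r : ℕ} {P : List (Fin n)} (hP : prefList I r = P.map Fin.val) (x : Fin n) :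
    score I r (x + 1) = if x ∈ P then n - P.idxOf x else 0 := by
  simp [score, hP, idxOf_map_val, Fin.val_inj]

theorem idxOf_lt_of_mem {r : ℕ} {P : List (Fin n)} (hP : prefList I r = P.map Fin.val) {x : Fin n}
    (hx : x ∈ P) : P.idxOf x < n := by
  have h := length_prefList_le I r
  rw [hP, List.length_map] at h
  exact (List.idxOf_lt_length_of_mem hx).trans_le h

theorem mem_of_score_pos {r : ℕ} {P : List (Fin n)} (hP : prefList I r = P.map Fin.val)
    {x : Fin n} (h : 0 < score I r (x + 1)) : x ∈ P := by
  by_contra hx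
  rw [score_eq hP, if_neg hx] at h
  exact lt_irrefl 0 h

theorem Prefers.mem {P : List (Fin n)} {x : Fin n} {o : Option (Fin n)}
    (h : Prefers P (some x) o) : x ∈ P := by
  by_contra hx
  rw [Prefers, rank, if_neg hx] at h
  exact not_top_lt h

theorem Prefers.score_pos {r : ℕ} {P : List (Fin n)} (hP : prefList I r = P.map Fin.val)
    {x : Fin n} {o : Option (Fin n)} (h : Prefers P (some x) o) : 0 < score I r (x + 1) := by
  have := idxOf_lt_of_mem hP h.mem
  rw [score_eq hP, if_pos h.mem]
  omega

theorem Prefers.score_lt {r : ℕ} {P : List (Fin n)} (hP : prefList I r = P.map Fin.val)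
    {x y : Fin n} (h : Prefers P (some x) (some y)) :
    score I r (y + 1) < score I r (x + 1) := by
  have hx := h.mem
  have := idxOf_lt_of_mem hP hx
  rw [score_eq hP, score_eq hP, if_pos hx]
  split_ifs with hy
  · rw [Prefers, rank, rank, if_pos hx, if_pos hy, Nat.cast_lt] at h
    omega
  · omega

variable (I)

/-- Acceptability is positivity of scores. The chain property excludes crossings, and a noncrossing
blocking pair would satisfy `Blocks`, since preferring is having a higher score. -/
theorem isWSNM_resultMatching : IsWSNM I (resultMatching I) := by
  refine ⟨fun i x h => ?_, fun i x j y hi hj => ?_, fun i x hb => ?_⟩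
  · rw [resultMatching_eq_some] at h
    have := edges_acceptable _ _ _ _ h
    exact ⟨mem_of_score_pos (prefList_man i) this.1, mem_of_score_pos (prefList_woman x) this.2⟩
  · rw [resultMatching_eq_some] at hi hj
    have h1 := edges_chain _ _ _ _ _ _ hi hj
    have h2 := edges_chain _ _ _ _ _ _ hj hi
    rw [Crosses, mul_neg_iff]
    omega
  · obtain ⟨⟨-, hm, hw⟩, hc⟩ := hb
    refine not_blocks_edges (score_zero I) (fun x => score_zero I (n + x)) n n i x i.2 x.2
      ⟨hm.score_pos (prefList_man i), hw.score_pos (prefList_woman x), fun y hy => ?_,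
        fun j hj => ?_, fun j y hj => ?_⟩
    · lift y to Fin n using (edges_lt _ _ _ _ hy).2
      rw [(resultMatching_eq_some I).mpr hy] at hm
      exact hm.score_lt (prefList_man i)
    · lift j to Fin n using (edges_lt _ _ _ _ hj).1
      rw [(resultMatching_symm_eq_some I).mpr hj] at hw
      exact hw.score_lt (prefList_woman x)
    · lift j to Fin n using (edges_lt _ _ _ _ hj).1
      lift y to Fin n using (edges_lt _ _ _ _ hj).2
      have := hc j y ((resultMatching_eq_some I).mpr hj)
      rw [Crosses, mul_neg_iff] at this
      omega

end

/-- All addresses lie below `8 * block n`. With `q = 2 ^ (Nat.log 2 n + 1)`, both `n + 1` and `2`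
are at most `q`, which gives six factors `q`. -/
theorem block_le_two_pow (n : ℕ) : 16 * block n ≤ 2 ^ (6 * (Nat.log 2 n + 1)) := by
  have h1 : n + 1 ≤ 2 ^ (Nat.log 2 n + 1) := Nat.lt_pow_succ_log_self one_lt_two n
  have h2 : 2 ≤ 2 ^ (Nat.log 2 n + 1) := Nat.le_self_pow (Nat.succ_ne_zero _) 2
  rw [mul_comm 6, pow_mul]
  generalize 2 ^ (Nat.log 2 n + 1) = q at h1 h2
  calc 16 * block n = 2 ^ 4 * ((n + 1) * (n + 1)) := by rw [block]; norm_num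
    _ ≤ q ^ 4 * (q * q) := by gcongr
    _ = q ^ 6 := by ring

end StableNoncrossing

/-- There is one word RAM program (with words of `O(log n)` bits) that, on every instance with
`n` men and `n` women with strict preference lists, halts within `O(n ^ 2)` steps and outputs a
weakly stable noncrossing matching. -/
theorem theorem2 :
    ∃ (P : StableNoncrossing.Prog) (c : ℕ) (T : ℕ → ℕ),
      (fun n : ℕ => (T n : ℝ)) =O[Filter.atTop] (fun n : ℕ => (n : ℝ) ^ 2) ∧
      ∀ (n : ℕ) (I : StableNoncrossing.Profile n),
        ∃ (t : ℕ) (s : StableNoncrossing.State) (M : StableNoncrossing.Matching n),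
          StableNoncrossing.Exec (c * (Nat.log 2 n + 1)) P (StableNoncrossing.initState I) t s ∧
          t ≤ T n ∧
          StableNoncrossing.Outputs s M ∧
          StableNoncrossing.IsWSNM I M := by
  refine ⟨StableNoncrossing.matchingProgram, 6, fun n => 10000 * (n * n + 1), ?_, fun n I => ?_⟩
  · refine Asymptotics.IsBigO.of_bound 20000 ?_
    filter_upwards [Filter.eventually_ge_atTop 1] with n hn
    have h : (1 : ℝ) ≤ n := by exact_mod_cast hn
    push_cast
    rw [Real.norm_of_nonneg (by positivity), Real.norm_of_nonneg (by positivity)]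
    nlinarith
  -- The final state agrees with one satisfying the invariant; agreement includes the memory, hence
  -- the output.
  · obtain ⟨t, ht, s, s', he, ha, h⟩ := StableNoncrossing.matchingProgram_runs (I := I)
      (StableNoncrossing.block_le_two_pow n) _ ⟨rfl, fun _ _ => rfl⟩
    refine ⟨t, s, StableNoncrossing.resultMatching I, he, ht, fun i => ?_,
      StableNoncrossing.isWSNM_resultMatching I⟩
    rw [ha.1]
    exact StableNoncrossing.outputs_resultMatching I h i
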